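/- **Networks.** A time-varying graph (TVG) $\mathcal G$ has a finite non-empty node set $V$ of $n$ nodes with unique identifiers (natural numbers), lifetime $[0,\infty)$, and a constant crossing delay $\zeta>0$. For each unordered pair $\{u,v\}$ of distinct nodes, the set of dates at which the edge $uv$ is present is a union of pairwise disjoint closed intervals of length at least $\zeta$. The footprint is the simple graph on $V$ whose edges are the pairs present at least once. An *appearance* of an edge is the first date of a maximal interval of presence. - $\mathcal R$: the footprint is connected, and whenever an edge is absent at a date $t$ it is present at some $t'>t$. - $\mathcal B$: graphs of $\mathcal R$ with a recurrence bound, that is, some $\Delta>0$ such that each edge first appears by date $\Delta$ and any two successive appearances of an edge are at most $\Delta$ apart. - $\mathcal P$: the footprint is connected, and for some $p>0$, each edge is present at $t$ if and only if it is present at $t+p$, for all $t\ge 0$. A *journey* from $u$ to $v$ is a sequence $(e_1,t_1),\dots,(e_k,t_k)$, $k\ge1$, where $e_1,\dots,e_k$ is a walk from $u$ to $v$, $e_i$ is present during all of $[t_i,t_i+\zeta]$, and $t_{i+1}\ge t_i+\zeta$; it has $k$ hops, departure $t_1$ and arrival $t_k+\zeta$. **Protocols.** All nodes run the same deterministic protocol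 from the starting date $t_0\ge 0$. At each date $t\ge t_0$ a node decides, from its local view only, which messages to send on its present incident edges and whether to enter a terminal state. The view consists of its identifier, whether it is the emitter, $t_0$, $t$, the presence of its incident edges (named by their other endpoint) during $[t_0,t]$, and the dated messages received so far. In addition all nodes are given $\zeta$ and the available knowledge. Local computation is unrestricted, but only finitely many messages may be sent in bounded time. A message sent on an edge at $t$ is received at $t+\zeta$ if the edge is present during all of $[t,t+\zeta]$, and is lost otherwise. Messages are marked as information or control messages; the information travels from the emitter along chains of delivered information messages. **Problems.** A protocol solves $\mathrm{TDB}$ (broadcast with termination detection) in $\mathcal G$ if for every emitter $x\in V$ and starting date $t_0\ge0$, the emitter enters its terminal state in finite time, and by then every other node has received the information. It solves - $\mathrm{TDB}[foremost]$ if, moreover, each node $v\neq x$ receives the information at the earliest arrival date of a journey from $x$ to $v$ departing at or after $t_0$; - $\mathrm{TDB}[shortest]$ if, moreover, each node $v\ne x$ receives the information for the first time through the least number of hops of a journey from $x$ to $v$ departing at or after $t_0$; - $\mathrm{TDB}[fastest]$ if, moreover (when $n\ge2$), the duration between the first emission of an information message by $x$ and the date at which the last node first receives the information equals the minimum of the $D$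 such that, for some $e\ge t_0$, every node other than $x$ can be reached from $x$ by a journey within $[e,e+D]$ (in particular this minimum exists). **Feasibility.** A context $\mathcal C_K$ is a class $\mathcal C$ with the kinds of knowledge $K$ given to the nodes: the number $n$ of nodes, a recurrence bound $\Delta$ of the graph, or a number $p>0$ modulo which the graph is periodic. Let $\mathscr P(\mathcal C_K)$ be the set of problems $P$ for which one protocol, with the knowledge as input, solves $P$ in every $\mathcal G\in\mathcal C$ for every correct value of the knowledge. For $\mathcal G\in\mathcal C$ and a correct value $\kappa$ of the knowledge, $P$ is feasible in $\mathcal G$ with knowledge $\kappa$ if some protocol, which may depend only on $\zeta$ and $\kappa$, solves $P$ in all graphs of $\mathcal C$ that have crossing delay $\zeta$ and for which $\kappa$ is correct. Write $P_1\preceq_{\mathcal C_K}P_2$ if for all $\mathcal G\in\mathcal C$ and all correct $\kappa$, $P_1$ is feasible in $\mathcal G$ with $\kappa$ whenever $P_2$ is. For a set $\mathcal L$ of contexts, $P_1\preceq_{\mathcal L}P_2$ means $P_1\preceq_{\mathcal C_K}P_2$ for all $\mathcal C_K\in\mathcal L$, and $P_1\prec_{\mathcal L}P_2$ means that $P_1\preceq_{\mathcal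 L}P_2$ and some $\mathcal C_K\in\mathcal L$ has $P_1\in\mathscr P(\mathcal C_K)$ and $P_2\notin\mathscr P(\mathcal C_K)$. **Theorem.** Let $\mathcal U=\{\mathcal R_n,\mathcal B_n,\mathcal B_\Delta,\mathcal B_{\{n,\Delta\}},\mathcal P_n,\mathcal P_\Delta,\mathcal P_{\{n,\Delta\}},\mathcal P_p\}$. Then $$\mathrm{TDB}[foremost]\prec_{\mathcal U}\mathrm{TDB}[shortest]\prec_{\mathcal U}\mathrm{TDB}[fastest].$$ Moreover, $\mathrm{TDB}[foremost]\in\mathscr P(\mathcal C_K)$ for every $\mathcal C_K\in\mathcal U$; $\mathrm{TDB}[shortest]\notin\mathscr P(\mathcal P_n)$; and, for $\mathcal C_K\in\mathcal U$, $\mathrm{TDB}[fastest]\in\mathscr P(\mathcal C_K)$ if and only if $\mathcal C_K=\mathcal P_p$. -/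

import Mathlib

open Set

namespace DynNet

/-! ### Time-varying graphs -/

/-- `S` is a union of pairwise disjoint closed intervals (bounded or unbounded to the right),
each of length at least `ζ`. -/
def IsUnionOfLongIntervals (ζ : ℝ) (S : Set ℝ) : Prop :=
  ∃ I : Set (Set ℝ), I.PairwiseDisjoint id ∧
    (∀ J ∈ I, (∃ a b : ℝ, a + ζ ≤ b ∧ J = Icc a b) ∨ (∃ a : ℝ, J = Ici a)) ∧ S = ⋃₀ I

/-- A time-varying graph with lifetime `[0, ∞)` and constant crossing delay `ζ > 0`. The nodes are
their own (unique) identifiers, which are natural numbers. `present u v` is the set of dates at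
which the undirected edge `uv` is present; there are no self-loops. -/
structure TVG where
  nodes : Finset ℕ
  nodes_nonempty : nodes.Nonempty
  ζ : ℝ
  ζ_pos : 0 < ζ
  present : ℕ → ℕ → Set ℝ
  present_symm : ∀ u v, present u v = present v u
  present_irrefl : ∀ u, present u u = ∅
  present_nodes : ∀ u v, (present u v).Nonempty → u ∈ nodes
  present_nonneg : ∀ u v, present u v ⊆ Ici 0
  present_intervals : ∀ u v, IsUnionOfLongIntervals ζ (present u v)

namespace TVG

variable (G : TVG)

/-- `uv` is an edge of the footprint: it is present at least once. -/
def IsEdge (u v : ℕ) : Prop := (G.present u v).Nonempty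

/-- The footprint (underlying static graph). -/
def footprint : SimpleGraph {u : ℕ // u ∈ G.nodes} where
  Adj u v := G.IsEdge u v
  symm := ⟨fun u v h => by
    have h' : (G.present u v).Nonempty := h
    rw [G.present_symm] at h'
    exact h'⟩
  loopless := ⟨fun u h => by
    have h' : (G.present u u).Nonempty := h
    rw [G.present_irrefl] at h'
    exact Set.not_nonempty_empty h'⟩

/-- The edge `uv` stays present for the whole time needed to cross it when starting at `t`. -/
def Crossable (u v : ℕ) (t : ℝ) : Prop := Icc t (t + G.ζ) ⊆ G.present u v

/-- `a` is a date at which the edge `uv` appears (the beginning of a maximal interval of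
presence; an edge that is present at date `0` appears at date `0`). -/
def Appears (u v : ℕ) (a : ℝ) : Prop :=
  a ∈ G.present u v ∧ ∃ ε > 0, ∀ s, a - ε < s → s < a → s ∉ G.present u v

/-- `Δ` bounds the recurrence time: every edge appears for the first time by date `Δ`, and the
time between two successive appearances of it is at most `Δ`. -/
def RecurrenceBound (Δ : ℝ) : Prop :=
  0 < Δ ∧ ∀ u v, G.IsEdge u v →
    (∃ a ≤ Δ, G.Appears u v a) ∧
    ∀ a a', G.Appears u v a → G.Appears u v a' → a < a' →
      (∀ b, a < b → b < a' → ¬ G.Appears u v b) → a' - a ≤ Δ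

/-- All edges repeat identically modulo `p` (equivalently: modulo every multiple of `p`). -/
def PeriodicWith (p : ℝ) : Prop :=
  0 < p ∧ ∀ u v t, 0 ≤ t → (t ∈ G.present u v ↔ t + p ∈ G.present u v)

end TVG

/-- The class of recurrent TVGs with connected footprint. -/
def classR : Set TVG :=
  {G | G.footprint.Connected ∧ ∀ u v, G.IsEdge u v →
    ∀ t, 0 ≤ t → t ∉ G.present u v → ∃ t' > t, t' ∈ G.present u v}

/-- The class of time-bounded recurrent TVGs with connected footprint. -/
def classB : Set TVG := {G | G ∈ classR ∧ ∃ Δ, G.RecurrenceBound Δ}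

/-- The class of periodic TVGs with connected footprint. -/
def classP : Set TVG := {G | G.footprint.Connected ∧ ∃ p, G.PeriodicWith p}

/-! ### Journeys -/

/-- `Journey C ζ u v k d a`: there is a journey from `u` to `v` with `k ≥ 1` hops, departure `d`
and arrival `a`, where `C w w' t` says that the hop from `w` to `w'` can be used at date `t`
and every hop takes time `ζ`. Waiting between two hops is allowed. -/
inductive Journey (C : ℕ → ℕ → ℝ → Prop) (ζ : ℝ) (u : ℕ) : ℕ → ℕ → ℝ → ℝ → Prop
  | single {v : ℕ} {t : ℝ} (h : C u v t) : Journey C ζ u v 1 t (t + ζ)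
  | snoc {v w k : ℕ} {d a t : ℝ} (j : Journey C ζ u v k d a) (ht : a ≤ t) (h : C v w t) :
      Journey C ζ u w (k + 1) d (t + ζ)

namespace TVG

variable (G : TVG)

/-- Journeys of the TVG. -/
def HasJourney (u v k : ℕ) (d a : ℝ) : Prop := Journey G.Crossable G.ζ u v k d a

/-- Arrival dates of the journeys from `u` to `v` with departure at `t` or later; the least
element is `t` plus the temporal distance. -/
def arrivals (u v : ℕ) (t : ℝ) : Set ℝ := {a | ∃ k d, t ≤ d ∧ G.HasJourney u v k d a}

/-- Numbers of hops of the journeys from `u` to `v` with departure at `t` or later; the least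
element is the topological distance. -/
def hopCounts (u v : ℕ) (t : ℝ) : Set ℕ := {k | ∃ d a, t ≤ d ∧ G.HasJourney u v k d a}

/-- The `D` such that, for some `e ≥ t`, every node other than `x` can be reached from `x` by a
journey that takes place within the time window `[e, e + D]`. -/
def broadcastDurations (x : ℕ) (t : ℝ) : Set ℝ :=
  {D | ∃ e ≥ t, ∀ v ∈ G.nodes, v ≠ x → ∃ k d a, e ≤ d ∧ a ≤ e + D ∧ G.HasJourney x v k d a}

end TVG

/-! ### Problems -/

/-- What is relevant of an execution for broadcast: `emits u v t` says that at date `t` node `u`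
sends to `v` an information message (whether or not it gets through), and `stopped t` says that
the emitter is in its terminal state at date `t`. -/
structure Trace where
  emits : ℕ → ℕ → ℝ → Prop
  stopped : ℝ → Prop

/-- The information has travelled from `x` to `v` in `k` hops, leaving `x` at date `d` and arriving
at date `a`, along information messages that were sent and successfully delivered. An information
message sent by a node that does not hold the information is on no such journey. -/
def InfoJourney (G : TVG) (T : Trace) (x v k : ℕ) (d a : ℝ) : Prop :=
  Journey (fun w w' t => T.emits w w' t ∧ G.Crossable w w' t) G.ζ x v k d a

/-- The dates at which node `v` receives the information held by `x`. -/
def receptions (G : TVG) (T : Trace) (x v : ℕ) : Set ℝ := {a | ∃ k d, InfoJourney G T x v k d a}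

/-- A problem about an emitter `x` with some information created at date `t₀`: it says
which traces are correct. -/
abbrev Problem := TVG → (x : ℕ) → (t₀ : ℝ) → Trace → Prop

/-- Broadcast with termination detection at the emitter: the emitter reaches its terminal state
at some date, and whenever it is in it, all nodes have received the information. -/
def TDB : Problem := fun G x _ T =>
  (∃ t, T.stopped t) ∧
  ∀ t, T.stopped t → ∀ v ∈ G.nodes, v ≠ x → ∃ r ≤ t, r ∈ receptions G T x v

/-- Every node receives the information at the earliest possible date. -/
def TDBforemost : Problem := fun G x t₀ T =>
  TDB G x t₀ T ∧
  ∀ v ∈ G.nodes, v ≠ x → ∃ r ∈ receptions G T x v, IsLeast (G.arrivals x v t₀) r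

/-- Every node receives the information (for the first time) in the minimal number of hops. -/
def TDBshortest : Problem := fun G x t₀ T =>
  TDB G x t₀ T ∧
  ∀ v ∈ G.nodes, v ≠ x → ∃ r k d, IsLeast (receptions G T x v) r ∧
    InfoJourney G T x v k d r ∧ IsLeast (G.hopCounts x v t₀) k

/-- The duration between the first emission of the information and the date at which
the last node has received it is minimal (nothing is required if `x` is the only node). -/
def TDBfastest : Problem := fun G x t₀ T =>
  TDB G x t₀ T ∧
  ((∃ v ∈ G.nodes, v ≠ x) → ∃ e l,
    IsLeast {t | ∃ v, T.emits x v t} e ∧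
    IsGreatest {r | ∃ v ∈ G.nodes, v ≠ x ∧ IsLeast (receptions G T x v) r} l ∧
    IsLeast (G.broadcastDurations x t₀) (l - e))

/-! ### Distributed protocols -/

/-- A message: a mark that tells whether it is an information message, and arbitrary
further (control) contents. -/
structure Message (M : Type) where
  info : Bool
  body : M

/-- All that a node knows at date `now` of an execution that started at date `start`, apart from
the common advice: its identifier, whether it is the emitter, the dates in `[start, now]` at which
its incident edges (named by their other endpoint) were present, and the messages received
up to now with the edge and the date of reception. -/
structure View (M : Type) where
  id : ℕ
  isEmitter : Prop
  start : ℝ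
  now : ℝ
  present : ℕ → Set ℝ
  received : ℕ → ℝ → Option (Message M)

/-- A deterministic distributed protocol, the same at all nodes, with unrestricted local
computation. At each date, `send` gives the message (if any) to be sent to a given neighbour, and
`halt` tells whether the node now enters its terminal state. -/
structure Protocol where
  Body : Type
  send : View Body → ℕ → Option (Message Body)
  halt : View Body → Prop

/-- The messages sent in an execution: `s u v t` is the message sent at date `t` by `u` to `v`. -/
abbrev Sends (M : Type) := ℕ → ℕ → ℝ → Option (Message M)

open Classical in
/-- The message that `v` receives from `u` at date `t`: the one sent by `u` at `t - ζ`, unless it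
is lost because the edge was not present during all of `[t - ζ, t]`. -/
noncomputable def delivered {M : Type} (G : TVG) (s : Sends M) (u v : ℕ) (t : ℝ) :
    Option (Message M) :=
  if G.Crossable u v (t - G.ζ) then s u v (t - G.ζ) else none

open Classical in
/-- The view of node `u` at date `t`. -/
noncomputable def viewAt {M : Type} (G : TVG) (x : ℕ) (t₀ : ℝ) (s : Sends M) (u : ℕ) (t : ℝ) :
    View M where
  id := u
  isEmitter := u = x
  start := t₀
  now := t
  present v := G.present u v ∩ Icc t₀ t
  received v r := if r ≤ t then delivered G s v u r else none

namespace Protocol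

variable (A : Protocol)

open Classical in
/-- `s` is the execution of `A` in `G` that starts at date `t₀` with emitter `x`. A message can be
sent only from date `t₀` on and on an edge that is present. -/
def IsExecution (G : TVG) (x : ℕ) (t₀ : ℝ) (s : Sends A.Body) : Prop :=
  ∀ u v t, s u v t =
    if t₀ ≤ t ∧ t ∈ G.present u v then A.send (viewAt G x t₀ s u t) v else none

/-- The trace of an execution. The terminal state, once entered, is never left. -/
def trace (G : TVG) (x : ℕ) (t₀ : ℝ) (s : Sends A.Body) : Trace where
  emits u v t := ∃ m, s u v t = some m ∧ m.info = true
  stopped t := ∃ t' ≤ t, t₀ ≤ t' ∧ A.halt (viewAt G x t₀ s x t')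

/-- `A` solves `P` in `G`: for every emitter and every starting date, an execution exists
and every execution is correct and has only finitely many messages in bounded time. -/
def Solves (P : Problem) (G : TVG) : Prop :=
  ∀ x ∈ G.nodes, ∀ t₀ : ℝ, 0 ≤ t₀ →
    (∃ s, A.IsExecution G x t₀ s) ∧
    ∀ s, A.IsExecution G x t₀ s →
      (∀ u v t, {r | r ≤ t ∧ s u v r ≠ none}.Finite) ∧ P G x t₀ (A.trace G x t₀ s)

end Protocol

/-! ### Knowledge, contexts and feasibility -/

/-- The kinds of knowledge: the number of nodes, a bound on the recurrence time, and the period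
(or a multiple of it). -/
inductive Kind
  | n
  | Δ
  | p

/-- What all nodes are told in advance; the crossing delay is always known. -/
structure Advice where
  ζ : ℝ
  n : Option ℕ
  Δ : Option ℝ
  p : Option ℝ

/-- `a` is a correct advice about `G` that consists of the kinds of knowledge in `K`. -/
def Reveals (K : Set Kind) (G : TVG) (a : Advice) : Prop :=
  a.ζ = G.ζ ∧
  (Kind.n ∈ K → a.n = some G.nodes.card) ∧ (Kind.n ∉ K → a.n = none) ∧
  (Kind.Δ ∈ K → ∃ Δ, a.Δ = some Δ ∧ G.RecurrenceBound Δ) ∧ (Kind.Δ ∉ K → a.Δ = none) ∧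
  (Kind.p ∈ K → ∃ p, a.p = some p ∧ G.PeriodicWith p) ∧ (Kind.p ∉ K → a.p = none)

/-- A context: a class of TVGs together with the kinds of knowledge that are available. -/
structure Context where
  graphs : Set TVG
  knowledge : Set Kind

def Rn : Context := ⟨classR, {Kind.n}⟩
def Bn : Context := ⟨classB, {Kind.n}⟩
def BΔ : Context := ⟨classB, {Kind.Δ}⟩
def BnΔ : Context := ⟨classB, {Kind.n, Kind.Δ}⟩
def Pn : Context := ⟨classP, {Kind.n}⟩
def PΔ : Context := ⟨classP, {Kind.Δ}⟩
def PnΔ : Context := ⟨classP, {Kind.n, Kind.Δ}⟩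
def Pp : Context := ⟨classP, {Kind.p}⟩

/-- The universe of the eight contexts. -/
def universeU : Set Context := {Rn, Bn, BΔ, BnΔ, Pn, PΔ, PnΔ, Pp}

/-- The problems that are feasible in the context `c`: one protocol, with the advice as input,
solves the problem in every TVG of the class, whatever correct advice it is given. -/
def feasibleProblems (c : Context) : Set Problem :=
  {P | ∃ A : Advice → Protocol, ∀ G ∈ c.graphs, ∀ a, Reveals c.knowledge G a → (A a).Solves P G}

/-- `P` is feasible with the advice `a` in the context `c`: a protocol, which may depend on
nothing but `a`, solves `P` in all TVGs of the class about which `a` is correct. -/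
def FeasibleWith (c : Context) (a : Advice) (P : Problem) : Prop :=
  ∃ A : Protocol, ∀ G ∈ c.graphs, Reveals c.knowledge G a → A.Solves P G

/-- In every TVG of the context and with every correct advice about it, `P₁` is feasible
if `P₂` is. -/
def NotHarderIn (c : Context) (P₁ P₂ : Problem) : Prop :=
  ∀ G ∈ c.graphs, ∀ a, Reveals c.knowledge G a → FeasibleWith c a P₂ → FeasibleWith c a P₁

/-- `P₁` is no more difficult than `P₂` over a set of contexts. -/
def NotHarder (L : Set Context) (P₁ P₂ : Problem) : Prop := ∀ c ∈ L, NotHarderIn c P₁ P₂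

/-- `P₁` is less difficult than `P₂` over a set of contexts. -/
def Easier (L : Set Context) (P₁ P₂ : Problem) : Prop :=
  NotHarder L P₁ P₂ ∧ ∃ c ∈ L, P₁ ∈ feasibleProblems c ∧ P₂ ∉ feasibleProblems c

end DynNet

/-! All positive results come from one family of protocols, `gossip`: nodes exchange everything they
know at regular ticks, whenever an edge appears, and at the first date at which they become active.
An edge that is crossable at `t` has been crossable since its last appearance. So a node active from
`a` on has passed the information by date `t` through every edge crossable at some `t ≥ a`
(`exists_fires`), and flooding is as fast as any journey (`flooding_le_journey`). This gives
foremost broadcast.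

Termination is detected by the emitter from the records of informed nodes (`Detects`). With `n`, it
counts them. With a bound `D` on the wait for a crossing (`Δ` or `p`), every node has seen all its
footprint edges `D` after the start, and a set of such late records closed under neighbours covers
the connected footprint.

Given `D`, footprint distance equals topological distance, and a breadth-first broadcast in phases
of length `D + ζ` is shortest (`holds_tick_iff`, `infoJourney_of_phase`). Given `p`, the emitter
learns the whole future from one observed period. An optimal window exists by compactness and
periodicity; the emitter waits for a translate of it that begins when its knowledge is complete,
then floods.

The negative results rest on causality: executions in two graphs that agree up to date `T` agree up
to `T` (`Protocol.IsExecution.congr`). For fastest broadcast, a star needs more than `ζ` until,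
after the protocol has stopped, a slot occurs in which `ζ` suffices. Neither `n` nor the recurrence
bound reveals this slot. For shortest broadcast with `n` only, a triangle edge that shows up late
turns an already completed two-hop delivery into a wrong one.

Foremost broadcast is feasible in every context, which settles the first comparison. For the second,
when only `n` is known, either `n ≤ 2` and foremost broadcasts are shortest, or `n ≥ 3` and fastest
broadcast is infeasible (`notHarderIn_of_count`). -/

namespace DynNet

/-! ### Separated sets of dates -/

/-- A set of reals that is bounded on both sides and whose points are at least `δ` apart
is finite. -/
theorem finite_of_separated {δ a b : ℝ} (hδ : 0 < δ) {S : Set ℝ} (hS : S ⊆ Icc a b)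
    (h : ∀ s ∈ S, ∀ t ∈ S, s < t → s + δ ≤ t) : S.Finite := by
  -- Rounding down in units of `δ` is injective on points `δ` apart and takes finitely many values.
  refine Set.Finite.of_finite_image (f := fun s => ⌊(s - a) / δ⌋₊) ?_ ?_
  · refine (Set.finite_Iic ⌊(b - a) / δ⌋₊).subset ?_
    rintro _ ⟨s, hs, rfl⟩
    have := hS hs
    exact Nat.floor_le_floor (by have := this.2; gcongr)
  · have key : ∀ s ∈ S, ∀ t ∈ S, s < t → ⌊(s - a) / δ⌋₊ < ⌊(t - a) / δ⌋₊ := by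
      intro s hs t ht hst
      have h1 := h s hs t ht hst
      have h0 : 0 ≤ (s - a) / δ := div_nonneg (by have := (hS hs).1; linarith) hδ.le
      have h2 : (s - a) / δ + 1 ≤ (t - a) / δ := by
        rw [div_add_one hδ.ne']; gcongr; linarith
      have h3 := Nat.floor_le_floor h2
      rw [Nat.floor_add_one h0] at h3
      omega
    intro s hs t ht hst
    rcases lt_trichotomy s t with hlt | rfl | hlt
    · exact absurd hst (key s hs t ht hlt).ne
    · rfl
    · exact absurd hst (key t ht s hs hlt).ne'

theorem finite_ticks {δ : ℝ} (hδ : 0 < δ) (a b : ℝ) :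
    {t : ℝ | t ≤ b ∧ ∃ k : ℕ, t = a + k * δ}.Finite := by
  refine finite_of_separated (a := a) (b := b) hδ ?_ ?_
  · rintro t ⟨h, k, rfl⟩
    exact ⟨by have : (0 : ℝ) ≤ k * δ := by positivity
              linarith, h⟩
  · rintro _ ⟨_, k, rfl⟩ _ ⟨_, l, rfl⟩ h
    have h1 : (k : ℝ) < l := by
      by_contra hc
      push Not at hc
      nlinarith
    have h2 : (k : ℝ) + 1 ≤ l := by exact_mod_cast h1
    nlinarith

/-- Induction on dates for a property that depends only on what happened at least `ζ` earlier. -/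
theorem delay_induction {ζ t₀ : ℝ} (hζ : 0 < ζ) {P : ℝ → Prop}
    (h : ∀ t, t₀ ≤ t → (∀ t', t₀ ≤ t' → t' + ζ ≤ t → P t') → P t) {t : ℝ} (ht : t₀ ≤ t) :
    P t := by
  -- The time after `t₀` is cut into slabs of length `ζ`; the hypothesis at `t` only refers to lower
  -- slabs.
  have key : ∀ n : ℕ, ∀ t, t₀ ≤ t → t < t₀ + n * ζ → P t := by
    intro n
    induction n with
    | zero => intro t h1 h2; simp at h2; linarith
    | succ n ih =>
      intro t h1 h2
      refine h t h1 fun t' h3 h4 => ih t' h3 ?_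
      push_cast at h2
      linarith
  obtain ⟨n, hn⟩ := exists_nat_gt ((t - t₀) / ζ)
  rw [div_lt_iff₀ hζ] at hn
  exact key n t ht (by linarith)

/-! ### Presence intervals -/

namespace TVG

variable {G : TVG} {u v : ℕ}

theorem isEdge_symm : G.IsEdge u v ↔ G.IsEdge v u := by
  unfold IsEdge; rw [G.present_symm]

theorem IsEdge.left_mem (h : G.IsEdge u v) : u ∈ G.nodes := G.present_nodes u v h

theorem IsEdge.right_mem (h : G.IsEdge u v) : v ∈ G.nodes := (isEdge_symm.1 h).left_mem

theorem Crossable.mem {t : ℝ} (h : G.Crossable u v t) : t ∈ G.present u v :=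
  h ⟨le_rfl, by have := G.ζ_pos; linarith⟩

theorem Crossable.isEdge {t : ℝ} (h : G.Crossable u v t) : G.IsEdge u v := ⟨t, h.mem⟩

theorem IsEdge.ne (h : G.IsEdge u v) : u ≠ v := by
  rintro rfl
  unfold IsEdge at h
  rw [G.present_irrefl] at h
  exact not_nonempty_empty h

/-- The presence intervals start with an appearance, from which the edge is crossable. -/
theorem exists_intervals (G : TVG) (u v : ℕ) : ∃ I : Set (Set ℝ), I.PairwiseDisjoint id ∧
    (∀ J ∈ I, IsClosed J) ∧ G.present u v = ⋃₀ I ∧ ∀ J ∈ I, ∀ t ∈ J, ∃ a ∈ J, a ≤ t ∧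
      Icc a t ⊆ G.present u v ∧ G.Appears u v a ∧ G.Crossable u v a := by
  obtain ⟨I, hdis, hI, hS⟩ := G.present_intervals u v
  refine ⟨I, hdis, ?_, hS, ?_⟩
  · intro J hJ
    rcases hI J hJ with ⟨a, b, -, rfl⟩ | ⟨a, rfl⟩
    · exact isClosed_Icc
    · exact isClosed_Ici
  intro J hJ t htJ
  have hζ := G.ζ_pos
  have start : ∀ J ∈ I, ∃ a, a ∈ J ∧ Icc a (a + G.ζ) ⊆ J ∧ (∀ y ∈ J, a ≤ y) ∧ J.OrdConnected := by
    intro J hJ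
    rcases hI J hJ with ⟨a, b, hab, rfl⟩ | ⟨a, rfl⟩
    · exact ⟨a, ⟨le_rfl, by linarith⟩, Icc_subset_Icc le_rfl hab, fun y hy => hy.1, ordConnected_Icc⟩
    · exact ⟨a, self_mem_Ici, fun y hy => hy.1, fun y hy => hy, ordConnected_Ici⟩
  have hsub : ∀ J ∈ I, J ⊆ G.present u v := fun J hJ => hS ▸ subset_sUnion_of_mem hJ
  have hne : ∀ J ∈ I, ∀ J' ∈ I, ∀ y ∈ J, ∀ z ∈ J', z ∈ J → y ∈ J' := by
    intro J hJ J' hJ' y hy z hz hz'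
    by_cases h : J = J'
    · exact h ▸ hy
    · exact absurd (hdis hJ hJ' h) (fun hd => Set.disjoint_left.1 hd hz' hz)
  obtain ⟨a, haJ, haζ, hale, hconn⟩ := start J hJ
  refine ⟨a, haJ, hale t htJ, (hconn.out haJ htJ).trans (hsub J hJ), ⟨hsub J hJ haJ, ?_⟩,
    haζ.trans (hsub J hJ)⟩
  -- If the edge is present less than `ζ` before `a`, the interval concerned ends at some `b < a`
  -- with `b > a - ζ`. An interval meeting `(b, a)` would start after `b` and, being of length at
  -- least `ζ`, contain `a`, against disjointness. So `a - b` serves as `ε`.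
  by_cases hex : ∃ s, a - G.ζ < s ∧ s < a ∧ s ∈ G.present u v
  · obtain ⟨s, hs1, hs2, hs⟩ := hex
    rw [hS] at hs
    obtain ⟨J', hJ', hsJ'⟩ := hs
    have haJ' : a ∉ J' := fun h => absurd (hale s (hne J' hJ' J hJ s hsJ' a haJ h)) (by linarith)
    obtain ⟨b, hbJ', hsb, hba, hbmax⟩ : ∃ b ∈ J', s ≤ b ∧ b < a ∧ ∀ y ∈ J', y ≤ b := by
      rcases hI J' hJ' with ⟨a', b, hab, rfl⟩ | ⟨a', rfl⟩
      · refine ⟨b, ⟨by linarith, le_rfl⟩, hsJ'.2, ?_, fun y hy => hy.2⟩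
        by_contra! h
        exact haJ' ⟨hsJ'.1.trans hs2.le, h⟩
      · exact absurd (show a' ≤ a from le_trans hsJ' hs2.le) haJ'
    refine ⟨a - b, by linarith, fun y hy1 hy2 hy => ?_⟩
    rw [hS] at hy
    obtain ⟨K, hK, hyK⟩ := hy
    obtain ⟨c, hcK, hcζ, hcle, hKconn⟩ := start K hK
    have haK : a ∉ K := fun h => absurd (hale y (hne K hK J hJ y hyK a haJ h)) (by linarith)
    have hbK : b < c := by
      by_contra! h
      have hb : b ∈ K := hKconn.out hcK hyK ⟨h, by linarith⟩
      linarith [hbmax y (hne K hK J' hJ' y hyK b hbJ' hb)]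
    exact haK (hcζ ⟨by linarith [hcle y hyK], by linarith⟩)
  · push Not at hex
    exact ⟨G.ζ, hζ, hex⟩

theorem exists_appears {t : ℝ} (ht : t ∈ G.present u v) :
    ∃ a ≤ t, Icc a t ⊆ G.present u v ∧ G.Appears u v a ∧ G.Crossable u v a := by
  obtain ⟨I, -, -, hS, h⟩ := G.exists_intervals u v
  rw [hS] at ht
  obtain ⟨J, hJ, htJ⟩ := ht
  obtain ⟨a, -, h⟩ := h J hJ t htJ
  exact ⟨a, h⟩

/-- The presence interval containing `a` cannot start before `a`, as the edge is absent just before;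
and it has length at least `ζ`. -/
theorem Appears.crossable {a : ℝ} (h : G.Appears u v a) : G.Crossable u v a := by
  obtain ⟨b, hb, hsub, -, hc⟩ := exists_appears h.1
  obtain ⟨ε, hε, hεs⟩ := h.2
  rcases hb.eq_or_lt with rfl | hlt
  · exact hc
  · refine absurd (hsub ⟨?_, ?_⟩) (hεs (max b (a - ε / 2)) ?_ ?_)
    · exact le_max_left _ _
    · exact max_le hb (by linarith)
    · exact lt_max_of_lt_right (by linarith)
    · exact max_lt hlt (by linarith)

theorem Appears.lt_of_subset {a b : ℝ} (h : G.Appears u v a) (hb : Icc b a ⊆ G.present u v) :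
    a ≤ b := by
  by_contra! hlt
  obtain ⟨ε, hε, hεs⟩ := h.2
  refine absurd (hb ⟨?_, ?_⟩) (hεs (max b (a - ε / 2)) ?_ ?_)
  · exact le_max_left _ _
  · exact max_le hlt.le (by linarith)
  · exact lt_max_of_lt_right (by linarith)
  · exact max_lt hlt (by linarith)

theorem Appears.separated {a b : ℝ} (ha : G.Appears u v a) (hb : G.Appears u v b) (h : a < b) :
    a + G.ζ ≤ b := by
  by_contra! hlt
  exact absurd (hb.lt_of_subset ((Icc_subset_Icc le_rfl hlt.le).trans ha.crossable)) (by linarith)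

theorem Appears.nonneg {a : ℝ} (ha : G.Appears u v a) : 0 ≤ a := G.present_nonneg u v ha.1

theorem finite_appears (T : ℝ) : {a | a ≤ T ∧ G.Appears u v a}.Finite :=
  finite_of_separated (a := 0) (b := T) G.ζ_pos (fun _ h => ⟨h.2.nonneg, h.1⟩)
    fun _ h _ h' hlt => h.2.separated h'.2 hlt

/-- The closed presence intervals form a locally finite family: those reaching below a given date
contain one of finitely many appearances, and by disjointness each appearance lies in only one of
them. -/
theorem isClosed_present (G : TVG) (u v : ℕ) : IsClosed (G.present u v) := by
  obtain ⟨I, hdis, hcl, hS, h⟩ := G.exists_intervals u v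
  have key : ∀ T, IsClosed (⋃ J ∈ {J | J ∈ I ∧ ∃ a ∈ J, a ≤ T ∧ G.Appears u v a}, J) := by
    intro T
    refine Set.Finite.isClosed_biUnion ?_ fun J hJ => hcl J hJ.1
    refine ((finite_appears (G := G) (u := u) (v := v) T).biUnion
      (t := fun a => {J | J ∈ I ∧ a ∈ J}) fun a _ => Set.Subsingleton.finite ?_).subset ?_
    · rintro J ⟨hJ, haJ⟩ J' ⟨hJ', haJ'⟩
      by_contra hne
      exact Set.disjoint_left.1 (hdis hJ hJ' hne) haJ haJ'
    · rintro J ⟨hJ, a, haJ, haT, ha⟩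
      exact mem_biUnion (show a ∈ {a | a ≤ T ∧ G.Appears u v a} from ⟨haT, ha⟩) ⟨hJ, haJ⟩
  refine IsSeqClosed.isClosed fun y z hy hyz => ?_
  have hmem : z ∈ ⋃ J ∈ {J | J ∈ I ∧ ∃ a ∈ J, a ≤ z + 1 ∧ G.Appears u v a}, J := by
    refine (key (z + 1)).mem_of_tendsto hyz ?_
    filter_upwards [hyz.eventually_le_const (lt_add_one z)] with n hn
    have := hy n
    rw [hS] at this
    obtain ⟨J, hJ, hyJ⟩ := this
    obtain ⟨a, haJ, hay, -, ha, -⟩ := h J hJ _ hyJ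
    exact mem_biUnion ⟨hJ, a, haJ, hay.trans hn, ha⟩ hyJ
  obtain ⟨J, hJ, hzJ⟩ := mem_iUnion₂.1 hmem
  rw [hS]
  exact ⟨J, hJ.1, hzJ⟩

/-- An intersection of translates of the closed set of presence dates. It is what makes the minimal
broadcast duration attained. -/
theorem isClosed_crossable (G : TVG) (u v : ℕ) : IsClosed {t | G.Crossable u v t} := by
  have : {t | G.Crossable u v t} = ⋂ y ∈ Icc 0 G.ζ, {t | t + y ∈ G.present u v} := by
    ext t
    simp only [mem_ofPred_eq, mem_iInter]
    constructor
    · exact fun h y hy => h ⟨by linarith [hy.1], by linarith [hy.2]⟩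
    · intro h y hy
      have := h (y - t) ⟨by linarith [hy.1], by linarith [hy.2]⟩
      simpa using this
  rw [this]
  exact isClosed_biInter fun y _ => (G.isClosed_present u v).preimage (by fun_prop)

/-- If an edge is crossable at `t`, it has been so since its last appearance. -/
theorem Crossable.exists_appears {t : ℝ} (h : G.Crossable u v t) :
    ∃ a ≤ t, G.Appears u v a ∧ ∀ s ∈ Icc a t, G.Crossable u v s := by
  obtain ⟨a, hat, hsub, hap, -⟩ := TVG.exists_appears h.mem
  refine ⟨a, hat, hap, fun s hs y hy => ?_⟩
  rcases le_total y t with hyt | hyt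
  · exact hsub ⟨hs.1.trans hy.1, hyt⟩
  · exact h ⟨hyt, hy.2.trans (by linarith [hs.2])⟩

/-- Every footprint edge can always be crossed again. -/
def Recurring (G : TVG) : Prop :=
  ∀ u v, G.IsEdge u v → ∀ t, 0 ≤ t → ∃ s ≥ t, G.Crossable u v s

/-- Every footprint edge can be crossed at some date of every window of length `D`. -/
def CrossBound (G : TVG) (D : ℝ) : Prop :=
  ∀ u v, G.IsEdge u v → ∀ t, 0 ≤ t → ∃ s ∈ Icc t (t + D), G.Crossable u v s

theorem CrossBound.recurring {D : ℝ} (h : G.CrossBound D) : G.Recurring := fun u v he t ht =>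
  let ⟨s, hs, hc⟩ := h u v he t ht
  ⟨s, hs.1, hc⟩

/-- In a recurrent TVG, an edge that no longer appears is present forever. -/
theorem crossable_of_no_appears (hG : G ∈ classR) (he : G.IsEdge u v) {t : ℝ} (ht : 0 ≤ t)
    (h : ∀ a, t < a → ¬ G.Appears u v a) : G.Crossable u v t := by
  intro y hy
  by_contra hyp
  obtain ⟨t', ht', hp⟩ := hG.2 u v he y (ht.trans hy.1) hyp
  obtain ⟨a, hat, hsub, hap, -⟩ := TVG.exists_appears hp
  refine h a ?_ hap
  by_contra! hc
  exact hyp (hsub ⟨hc.trans hy.1, ht'.le⟩)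

theorem recurring_of_mem_classR (hG : G ∈ classR) : G.Recurring := by
  intro u v he t ht
  by_cases h : ∃ a, t < a ∧ G.Appears u v a
  · obtain ⟨a, hta, ha⟩ := h
    exact ⟨a, hta.le, ha.crossable⟩
  · push Not at h
    exact ⟨t, le_rfl, crossable_of_no_appears hG he ht h⟩

/-- The next appearance after `t` comes at most `Δ` after the last one by `t`, or, if there is none,
no later than the first one, which is by `Δ`. If nothing appears after `t`, recurrence forces the
edge to stay present. -/
theorem RecurrenceBound.crossBound (hG : G ∈ classR) {Δ : ℝ} (hΔ : G.RecurrenceBound Δ) :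
    G.CrossBound Δ := by
  intro u v he t ht
  obtain ⟨hpos, h⟩ := hΔ
  obtain ⟨⟨a₀, ha₀, hap₀⟩, hgap⟩ := h u v he
  by_cases hex : ∃ a, t < a ∧ G.Appears u v a
  · obtain ⟨b, hb⟩ := hex
    obtain ⟨a', ⟨⟨-, hta', ha'⟩, hmin⟩⟩ := Set.exists_min_image
      {a | a ≤ b ∧ t < a ∧ G.Appears u v a} id
      ((finite_appears b).subset fun a ha => ⟨ha.1, ha.2.2⟩) ⟨b, le_rfl, hb⟩
    have hmin' : ∀ c, t < c → c < a' → ¬ G.Appears u v c := by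
      intro c hc1 hc2 hc
      by_cases hcb : c ≤ b
      · exact absurd (hmin c ⟨hcb, hc1, hc⟩) (not_le.2 hc2)
      · exact absurd (hmin b ⟨le_rfl, hb⟩) (by simp only [id]; linarith)
    refine ⟨a', ⟨hta'.le, ?_⟩, ha'.crossable⟩
    by_cases hlast : ∃ a ≤ t, G.Appears u v a
    · obtain ⟨a, ⟨hat, ha⟩, hmax⟩ := Set.exists_max_image {a | a ≤ t ∧ G.Appears u v a} id
        (finite_appears t) (by obtain ⟨a, h1, h2⟩ := hlast; exact ⟨a, h1, h2⟩)
      have := hgap a a' ha ha' (by linarith) fun c hc1 hc2 hc => by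
        by_cases hct : c ≤ t
        · exact absurd (hmax c ⟨hct, hc⟩) (not_le.2 hc1)
        · exact hmin' c (not_le.1 hct) hc2 hc
      linarith
    · push Not at hlast
      have h1 : t < a₀ := by
        by_contra! hc
        exact hlast a₀ hc hap₀
      have h2 : a' ≤ a₀ := by
        by_contra! hc
        exact hmin' a₀ h1 hc hap₀
      linarith
  · push Not at hex
    exact ⟨t, ⟨le_rfl, by linarith⟩, crossable_of_no_appears hG he ht hex⟩

/-! ### Periodic TVGs -/

theorem PeriodicWith.mem_add_iff {p : ℝ} (hp : G.PeriodicWith p) (m : ℕ) {t : ℝ} (ht : 0 ≤ t) :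
    t + m * p ∈ G.present u v ↔ t ∈ G.present u v := by
  induction m with
  | zero => simp
  | succ m ih =>
    have hpos := hp.1
    rw [← ih, hp.2 u v (t + m * p) (by positivity)]
    push_cast
    rw [show t + (m + 1) * p = t + m * p + p by ring]

theorem PeriodicWith.crossable_add_iff {p : ℝ} (hp : G.PeriodicWith p) (m : ℕ) {t : ℝ}
    (ht : 0 ≤ t) : G.Crossable u v (t + m * p) ↔ G.Crossable u v t := by
  constructor
  · intro h y hy
    rw [← hp.mem_add_iff m (ht.trans hy.1)]
    exact h ⟨by linarith [hy.1], by linarith [hy.2]⟩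
  · intro h y hy
    have := (hp.mem_add_iff (u := u) (v := v) m (t := y - m * p) (by linarith [hy.1])).2
      (h ⟨by linarith [hy.1], by linarith [hy.2]⟩)
    simpa using this

/-- Every date can be written as a date of a given window of length `p`, up to a multiple
of `p`. -/
theorem exists_shift {p t s : ℝ} (hp : 0 < p) (h : t ≤ s) :
    ∃ m : ℕ, ∃ r, t ≤ r ∧ r < t + p ∧ s = r + m * p := by
  refine ⟨⌊(s - t) / p⌋₊, s - ⌊(s - t) / p⌋₊ * p, ?_, ?_, by ring⟩
  · have := Nat.floor_le (div_nonneg (sub_nonneg.2 h) hp.le)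
    rw [le_div_iff₀ hp] at this
    linarith
  · have := Nat.lt_floor_add_one ((s - t) / p)
    rw [div_lt_iff₀ hp] at this
    linarith

theorem PeriodicWith.crossBound {p : ℝ} (hp : G.PeriodicWith p) : G.CrossBound p := by
  rintro u v ⟨t', ht'⟩ t ht
  -- An appearance is moved past `t` by `k` periods, then reduced into `[t, t + p)`.
  obtain ⟨a, -, -, ha, hc⟩ := TVG.exists_appears ht'
  obtain ⟨k, hk⟩ := exists_nat_gt ((t - a) / p)
  rw [div_lt_iff₀ hp.1] at hk
  obtain ⟨m, r, h1, h2, h3⟩ := exists_shift (s := a + k * p) hp.1 (show t ≤ a + k * p by linarith)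
  refine ⟨r, ⟨h1, h2.le⟩, ?_⟩
  rw [← hp.crossable_add_iff m (ht.trans h1), ← h3, hp.crossable_add_iff k ha.nonneg]
  exact hc

theorem classP_subset_classR : classP ⊆ classR := by
  rintro G ⟨hc, p, hp⟩
  refine ⟨hc, fun u v he t ht _ => ?_⟩
  obtain ⟨s, hs, h⟩ := hp.crossBound u v he (t + 1) (by linarith)
  exact ⟨s, by linarith [hs.1], h.mem⟩

/-! ### Connectivity -/

/-- A set of nodes that contains `x` and is closed under footprint edges contains every node. -/
theorem forall_nodes_of_closed (hG : G.footprint.Connected) {x : ℕ} {P : ℕ → Prop}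
    (hx : x ∈ G.nodes) (hPx : P x) (h : ∀ u v, P u → G.IsEdge u v → P v) :
    ∀ v ∈ G.nodes, P v := by
  intro v hv
  obtain ⟨w⟩ := hG.preconnected ⟨x, hx⟩ ⟨v, hv⟩
  suffices ∀ (a b : {u : ℕ // u ∈ G.nodes}), G.footprint.Walk a b → P a → P b from
    this _ _ w hPx
  intro a b w
  induction w with
  | nil => exact id
  | cons hadj _ ih => exact fun ha => ih (h _ _ ha hadj)

end TVG

/-! ### Journeys -/

namespace Journey

variable {C C' : ℕ → ℕ → ℝ → Prop} {ζ : ℝ} {u v k : ℕ} {d a : ℝ}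

theorem one_le (h : Journey C ζ u v k d a) : 1 ≤ k := by
  cases h <;> omega

theorem add_le (h : Journey C ζ u v k d a) : d + k * ζ ≤ a := by
  induction h with
  | single h => simp
  | snoc j ht h ih => push_cast; linarith

theorem lt (hζ : 0 < ζ) (h : Journey C ζ u v k d a) : d < a := by
  have h1 : (1 : ℝ) ≤ k := by exact_mod_cast h.one_le
  have := h.add_le
  nlinarith

theorem exists_first (h : Journey C ζ u v k d a) : ∃ w, C u w d := by
  induction h with
  | single h => exact ⟨_, h⟩
  | snoc j ht h ih => exact ih

theorem exists_last (h : Journey C ζ u v k d a) :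
    ∃ w t, C w v t ∧ a = t + ζ ∧ (w = u ∨ ∃ j b, Journey C ζ u w j d b ∧ b ≤ t) := by
  cases h with
  | single h => exact ⟨u, _, h, rfl, Or.inl rfl⟩
  | snoc j ht h => exact ⟨_, _, h, rfl, Or.inr ⟨_, _, j, ht⟩⟩

theorem crossing_of_one (h : Journey C ζ u v 1 d a) : C u v d ∧ a = d + ζ := by
  cases h with
  | single h => exact ⟨h, rfl⟩
  | snoc j ht h => exact absurd j.one_le (by omega)

/-- The implication is only required between departure and arrival, so that relations agreeing only
up to, or only from, some date can be compared. -/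
theorem mono (hζ : 0 < ζ) (h : Journey C ζ u v k d a)
    (hC : ∀ w w' t, d ≤ t → t + ζ ≤ a → C w w' t → C' w w' t) : Journey C' ζ u v k d a := by
  induction h with
  | single h => exact .single (hC _ _ _ le_rfl le_rfl h)
  | snoc j ht h ih =>
    have := j.lt hζ
    exact .snoc (ih fun w w' t h1 h2 => hC w w' t h1 (by linarith)) ht
      (hC _ _ _ (by linarith) le_rfl h)

theorem shift (h : Journey C ζ u v k d a) (s : ℝ) (hζ : 0 < ζ)
    (hC : ∀ w w' t, d ≤ t → C w w' t → C' w w' (t + s)) :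
    Journey C' ζ u v k (d + s) (a + s) := by
  induction h with
  | @single v t h => rw [show t + ζ + s = t + s + ζ by ring]; exact .single (hC _ _ _ le_rfl h)
  | @snoc v w k d a t j ht h ih =>
    have := j.lt hζ
    rw [show t + ζ + s = t + s + ζ by ring]
    exact .snoc (ih hC) (by linarith) (hC _ _ _ (by linarith) h)

end Journey

/-! ### Executions -/

theorem delivered_eq_some {M : Type} {G : TVG} {s : Sends M} {u v : ℕ} {t : ℝ} {m : Message M} :
    delivered G s u v t = some m ↔ G.Crossable u v (t - G.ζ) ∧ s u v (t - G.ζ) = some m := by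
  unfold delivered
  split_ifs with h <;> simp [h]

/-- The view at date `t` depends only on presence up to date `t` and on the messages sent
before `t - ζ`. -/
theorem viewAt_congr {M : Type} {G G' : TVG} (hζ : G'.ζ = G.ζ) {s s' : Sends M} {x u : ℕ}
    {t₀ t : ℝ} (hG : ∀ u v, ∀ r ≤ t, r ∈ G.present u v ↔ r ∈ G'.present u v)
    (hs : ∀ u v r, r + G.ζ ≤ t → s u v r = s' u v r) :
    viewAt G x t₀ s u t = viewAt G' x t₀ s' u t := by
  unfold viewAt
  congr 1
  · funext v
    ext r
    simp only [mem_inter_iff, mem_Icc]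
    constructor
    · exact fun h => ⟨(hG _ _ _ h.2.2).1 h.1, h.2⟩
    · exact fun h => ⟨(hG _ _ _ h.2.2).2 h.1, h.2⟩
  · funext v r
    split_ifs with hr
    · have hc : G.Crossable v u (r - G.ζ) ↔ G'.Crossable v u (r - G'.ζ) := by
        unfold TVG.Crossable
        rw [hζ]
        constructor
        · exact fun h y hy => (hG _ _ _ (by linarith [hy.2])).1 (h hy)
        · exact fun h y hy => (hG _ _ _ (by linarith [hy.2])).2 (h hy)
      unfold delivered
      rw [hs v u (r - G.ζ) (by linarith), hζ]
      rw [hζ] at hc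
      by_cases h : G.Crossable v u (r - G.ζ)
      · rw [if_pos h, if_pos (hc.1 h)]
      · rw [if_neg h, if_neg (fun h' => h (hc.2 h'))]
    · rfl

namespace Protocol

variable {A : Protocol} {G : TVG} {x : ℕ} {t₀ : ℝ} {s : Sends A.Body}

theorem IsExecution.send_eq (hs : A.IsExecution G x t₀ s) {u v : ℕ} {t : ℝ} (ht : t₀ ≤ t)
    (hp : t ∈ G.present u v) : s u v t = A.send (viewAt G x t₀ s u t) v := by
  rw [hs u v t, if_pos ⟨ht, hp⟩]

theorem IsExecution.of_eq_some (hs : A.IsExecution G x t₀ s) {u v : ℕ} {t : ℝ}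
    {m : Message A.Body} (h : s u v t = some m) :
    t₀ ≤ t ∧ t ∈ G.present u v ∧ A.send (viewAt G x t₀ s u t) v = some m := by
  rw [hs u v t] at h
  split_ifs at h with hc
  exact ⟨hc.1, hc.2, h⟩

/-- Executions in two TVGs that agree up to date `T` agree up to date `T`. -/
theorem IsExecution.congr {G' : TVG} (hζ : G'.ζ = G.ζ) {T : ℝ}
    (hG : ∀ u v, ∀ r ≤ T, r ∈ G.present u v ↔ r ∈ G'.present u v) {s' : Sends A.Body}
    (hs : A.IsExecution G x t₀ s) (hs' : A.IsExecution G' x t₀ s') :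
    ∀ u v, ∀ t ≤ T, s u v t = s' u v t := by
  have before : ∀ u v t, t < t₀ → s u v t = s' u v t := by
    intro u v t ht
    rw [hs, hs', if_neg (fun h => not_lt.2 h.1 ht), if_neg (fun h => not_lt.2 h.1 ht)]
  have key : ∀ t, t₀ ≤ t → t ≤ T → ∀ u v, s u v t = s' u v t := by
    intro t ht
    refine delay_induction (P := fun t => t ≤ T → ∀ u v, s u v t = s' u v t) G.ζ_pos ?_ ht
    intro t ht ih htT u v
    have hζpos := G.ζ_pos
    rw [hs, hs', viewAt_congr hζ (fun u v r hr => hG u v r (hr.trans htT)) (s' := s')]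
    · have := hG u v t htT
      by_cases hc : t ∈ G.present u v
      · rw [if_pos ⟨ht, hc⟩, if_pos ⟨ht, this.1 hc⟩]
      · rw [if_neg (fun h => hc h.2), if_neg (fun h => hc (this.2 h.2))]
    · intro u v r hr
      rcases lt_or_ge r t₀ with h | h
      · exact before u v r h
      · exact ih r h hr (by linarith) u v
  intro u v t ht
  rcases lt_or_ge t t₀ with h | h
  · exact before u v t h
  · exact key t h ht u v

variable (A) (G) (x) (t₀) in
open Classical in
/-- The messages of the execution that depend on at most `n` successive receptions. -/
noncomputable def approxExecution : ℕ → Sends A.Body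
  | 0 => fun _ _ _ => none
  | n + 1 => fun u v t => if t₀ ≤ t ∧ t ∈ G.present u v then
      A.send (viewAt G x t₀ (approxExecution n) u t) v else none

/-- Each round settles a further span `ζ` of dates, because a view at `t` only involves messages
sent by `t - ζ`. -/
theorem approxExecution_succ (n : ℕ) : ∀ u v t, t < t₀ + n * G.ζ →
    A.approxExecution G x t₀ (n + 1) u v t = A.approxExecution G x t₀ n u v t := by
  induction n with
  | zero =>
    intro u v t ht
    simp only [Nat.cast_zero, zero_mul, add_zero] at ht
    simp [approxExecution, not_le.2 ht]
  | succ n ih =>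
    intro u v t ht
    push_cast at ht
    conv_lhs => rw [approxExecution]
    conv_rhs => rw [approxExecution]
    beta_reduce
    rw [viewAt_congr (G := G) (t := t) rfl (fun _ _ _ _ => Iff.rfl)
      (fun u v r hr => ih u v r (by linarith))]

theorem approxExecution_of_le {n m : ℕ} (h : n ≤ m) {u v : ℕ} {t : ℝ}
    (ht : t < t₀ + n * G.ζ) :
    A.approxExecution G x t₀ m u v t = A.approxExecution G x t₀ n u v t := by
  induction m, h using Nat.le_induction with
  | base => rfl
  | succ m hm ih =>
    rw [approxExecution_succ, ih]
    have : (n : ℝ) ≤ m := by exact_mod_cast hm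
    have := G.ζ_pos
    nlinarith

variable (A) (G) (x) (t₀) in
theorem exists_isExecution : ∃ s, A.IsExecution G x t₀ s := by
  have hζ := G.ζ_pos
  -- After `N t` rounds the messages of date `t` are final; the `+ 1` makes the bound `hN` strict.
  -- The execution is the diagonal of the approximations.
  let N : ℝ → ℕ := fun t => ⌊(t - t₀) / G.ζ⌋₊ + 1
  have hN : ∀ t, t < t₀ + N t * G.ζ := fun t => by
    have := Nat.lt_floor_add_one ((t - t₀) / G.ζ)
    rw [div_lt_iff₀ hζ] at this
    simp only [N]
    push_cast
    linarith
  refine ⟨fun u v t => A.approxExecution G x t₀ (N t) u v t, fun u v t => ?_⟩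
  beta_reduce
  rw [← approxExecution_succ (N t) u v t (hN t), approxExecution]
  beta_reduce
  rw [viewAt_congr (G := G) (t := t) rfl (fun _ _ _ _ => Iff.rfl) (fun u v r hr => ?_)]
  refine approxExecution_of_le ?_ (hN r)
  simp only [N]
  gcongr
  linarith

end Protocol

/-! ### Receptions -/

theorem InfoJourney.hasJourney {G : TVG} {T : Trace} {x v k : ℕ} {d a : ℝ}
    (h : InfoJourney G T x v k d a) : G.HasJourney x v k d a :=
  Journey.mono G.ζ_pos h fun _ _ _ _ _ h => h.2

theorem mem_receptions {G : TVG} {T : Trace} {x v : ℕ} {r : ℝ} (h : r ∈ receptions G T x v) :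
    ∃ w t, T.emits w v t ∧ G.Crossable w v t ∧ r = t + G.ζ ∧
      (w = x ∨ ∃ b ∈ receptions G T x w, b ≤ t) := by
  obtain ⟨k, d, h⟩ := h
  obtain ⟨w, t, ⟨h1, h2⟩, h3, h4⟩ := Journey.exists_last h
  refine ⟨w, t, h1, h2, h3, h4.imp id ?_⟩
  rintro ⟨j, b, hj, hb⟩
  exact ⟨b, ⟨j, d, hj⟩, hb⟩

theorem mem_receptions_of_emits {G : TVG} {T : Trace} {x w v : ℕ} {t : ℝ}
    (he : T.emits w v t) (hc : G.Crossable w v t)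
    (hw : w = x ∨ ∃ b ∈ receptions G T x w, b ≤ t) : t + G.ζ ∈ receptions G T x v := by
  rcases hw with rfl | ⟨b, ⟨k, d, hj⟩, hb⟩
  · exact ⟨1, t, .single ⟨he, hc⟩⟩
  · exact ⟨k + 1, d, .snoc hj hb ⟨he, hc⟩⟩

/-- If messages are sent finitely often in bounded time, so are they received. -/
theorem finite_receptions {A : Protocol} {G : TVG} {x x' : ℕ} {t₀ : ℝ} {s : Sends A.Body}
    (hfin : ∀ u v t, {r | r ≤ t ∧ s u v r ≠ none}.Finite) (v : ℕ) (T : ℝ) :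
    {r | r ≤ T ∧ r ∈ receptions G (A.trace G x t₀ s) x' v}.Finite := by
  refine (G.nodes.finite_toSet.biUnion fun w _ => (hfin w v T).image (· + G.ζ)).subset ?_
  rintro r ⟨hrT, hr⟩
  obtain ⟨w, t, ⟨m, hm, -⟩, hc, rfl, -⟩ := mem_receptions hr
  have := G.ζ_pos
  exact mem_biUnion hc.isEdge.left_mem ⟨t, ⟨by linarith, by simp [hm]⟩, rfl⟩

theorem exists_isLeast_of_finite_below {S : Set ℝ} (hne : S.Nonempty)
    (hfin : ∀ T, {r | r ≤ T ∧ r ∈ S}.Finite) : ∃ r, IsLeast S r := by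
  obtain ⟨b, hb⟩ := hne
  obtain ⟨r, hr, hmin⟩ := Set.exists_min_image _ id (hfin b) ⟨b, le_rfl, hb⟩
  refine ⟨r, hr.2, fun y hy => ?_⟩
  rcases le_total y b with h | h
  · exact hmin y ⟨h, hy⟩
  · exact hr.1.trans h

theorem Protocol.IsExecution.le_of_mem_receptions {A : Protocol} {G : TVG} {x v : ℕ} {t₀ : ℝ}
    {s : Sends A.Body} (hs : A.IsExecution G x t₀ s) {k : ℕ} {d a : ℝ}
    (h : InfoJourney G (A.trace G x t₀ s) x v k d a) : t₀ ≤ d := by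
  obtain ⟨w, ⟨m, hm, -⟩, -⟩ := Journey.exists_first h
  exact (hs.of_eq_some hm).1

/-! ### Gossip protocols -/

namespace View

variable {M : Type}

/-- What a node knew at the earlier date `t`. -/
noncomputable def truncate (V : View M) (t : ℝ) : View M :=
  open Classical in
  { V with
    now := t
    present := fun v => V.present v ∩ Iic t
    received := fun v r => if r ≤ t then V.received v r else none }

/-- The node is the emitter or has received an information message. -/
def holds (V : View M) : Prop :=
  V.isEmitter ∨ ∃ w r m, V.received w r = some m ∧ m.info = true

/-- The edge to `v` is present now but was not just before. -/
def appears (V : View M) (v : ℕ) : Prop :=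
  V.now ∈ V.present v ∧ ∃ ε > 0, ∀ s, V.now - ε < s → s < V.now → s ∉ V.present v

end View

/-- A record of a node about itself: its identifier, the date, the observed presence of its edges
up to that date, and whether it holds the information. -/
structure Rec where
  id : ℕ
  now : ℝ
  present : ℕ → Set ℝ
  informed : Prop

namespace View

/-- The present record of a node. -/
def record {M : Type} (V : View M) : Rec := ⟨V.id, V.now, V.present, V.holds⟩

/-- All records that a node has made or heard of. -/
def records (V : View (Set Rec)) : Set Rec :=
  {ρ | (∃ t, V.start ≤ t ∧ t ≤ V.now ∧ ρ = (V.truncate t).record) ∨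
    ∃ w r m, V.received w r = some m ∧ ρ ∈ m.body}

/-- A message is sent at the ticks (separated by `τ`), when the edge appears, and at the first
date at which `act` holds. -/
def fires (τ : ℝ) (act : View (Set Rec) → Prop) (V : View (Set Rec)) (v : ℕ) : Prop :=
  (∃ k : ℕ, V.now = V.start + k * τ) ∨ V.appears v ∨
    (act V ∧ ∀ t, V.start ≤ t → t < V.now → ¬ act (V.truncate t))

end View

open Classical in
/-- Nodes exchange all the records they know; the messages are information messages when `act`
holds. The emitter halts when the records of informed nodes satisfy `cmp`. -/
noncomputable def gossip (τ : ℝ) (act : View (Set Rec) → Prop) (cmp : ℝ → Set Rec → Prop) :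
    Protocol where
  Body := Set Rec
  send V v := if V.fires τ act v then some ⟨decide (act V), V.records⟩ else none
  halt V := cmp V.start {ρ | ρ ∈ V.records ∧ ρ.informed}

/-- Nodes forget nothing, so conditions on the past, such as being the first date at which something
holds, can be decided from the present view. -/
theorem viewAt_truncate {M : Type} {G : TVG} {x u : ℕ} {t₀ t t' : ℝ} {s : Sends M} (h : t' ≤ t) :
    (viewAt G x t₀ s u t).truncate t' = viewAt G x t₀ s u t' := by
  unfold viewAt View.truncate
  congr 1
  · funext v
    ext r
    simp only [mem_inter_iff, mem_Icc, mem_Iic]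
    constructor
    · exact fun ⟨⟨h1, h2, _⟩, h3⟩ => ⟨h1, h2, h3⟩
    · exact fun ⟨h1, h2, h3⟩ => ⟨⟨h1, h2, h3.trans h⟩, h3⟩
  · funext v r
    by_cases hr : r ≤ t'
    · simp [hr, hr.trans h]
    · simp [hr]

theorem received_eq_some {M : Type} {G : TVG} {x u w : ℕ} {t₀ t r : ℝ} {s : Sends M}
    {m : Message M} : (viewAt G x t₀ s u t).received w r = some m ↔
      r ≤ t ∧ G.Crossable w u (r - G.ζ) ∧ s w u (r - G.ζ) = some m := by
  unfold viewAt
  by_cases h : r ≤ t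
  · simp [h, delivered_eq_some]
  · simp [h]

/-- The records about a TVG that have been made since `t₀`. -/
def Truthful (G : TVG) (t₀ : ℝ) (R : Set Rec) : Prop :=
  ∀ ρ ∈ R, ρ.id ∈ G.nodes ∧ t₀ ≤ ρ.now ∧ ∀ v, ρ.present v = G.present ρ.id v ∩ Icc t₀ ρ.now

/-- `cmp` recognizes the sets of records that cover all nodes. -/
structure Detects (G : TVG) (cmp : ℝ → Set Rec → Prop) : Prop where
  sound : ∀ t₀, 0 ≤ t₀ → ∀ R, Truthful G t₀ R → cmp t₀ R → ∀ v ∈ G.nodes, ∃ ρ ∈ R, ρ.id = v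
  live : ∀ t₀, 0 ≤ t₀ → ∃ D, ∀ R, Truthful G t₀ R →
    (∀ v ∈ G.nodes, ∃ ρ ∈ R, ρ.id = v ∧ D ≤ ρ.now) → cmp t₀ R

/-- There are records of `n` nodes. -/
def countNodes (n : ℕ) (_ : ℝ) (R : Set Rec) : Prop := (Rec.id '' R).ncard = n

/-- The records made at least `D` after the start are closed under neighbours. -/
def closedNodes (D : ℝ) (t₀ : ℝ) (R : Set Rec) : Prop :=
  (∃ ρ ∈ R, t₀ + D ≤ ρ.now) ∧
    ∀ ρ ∈ R, t₀ + D ≤ ρ.now → ∀ v, (ρ.present v).Nonempty →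
      ∃ ρ' ∈ R, t₀ + D ≤ ρ'.now ∧ ρ'.id = v

theorem detects_countNodes (G : TVG) : Detects G (countNodes G.nodes.card) where
  sound t₀ _ R hR h v hv := by
    have hsub : Rec.id '' R ⊆ G.nodes := by
      rintro _ ⟨ρ, hρ, rfl⟩
      exact (hR ρ hρ).1
    have := Set.eq_of_subset_of_ncard_le hsub (by
      rw [Set.ncard_coe_finset]
      exact (show (Rec.id '' R).ncard = _ from h).ge) G.nodes.finite_toSet
    have hv' : v ∈ Rec.id '' R := by rw [this]; exact hv
    obtain ⟨ρ, hρ, h⟩ := hv'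
    exact ⟨ρ, hρ, h⟩
  live t₀ _ := by
    refine ⟨0, fun R hR h => ?_⟩
    have : Rec.id '' R = G.nodes := by
      ext v
      constructor
      · rintro ⟨ρ, hρ, rfl⟩
        exact (hR ρ hρ).1
      · intro hv
        obtain ⟨ρ, hρ, h1, -⟩ := h v hv
        exact ⟨ρ, hρ, h1⟩
    simp [countNodes, this]

/-- A record made `D` after the start shows all footprint edges of its node, so closure under
observed neighbours is closure in the footprint. The date is kept in the conclusion because
`bestStart_eq` needs a full period of observation from every node. -/
theorem closedNodes_sound {G : TVG} (hG : G.footprint.Connected) {D : ℝ} (hD : G.CrossBound D)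
    {t₀ : ℝ} (ht₀ : 0 ≤ t₀) {R : Set Rec} (hR : Truthful G t₀ R) (h : closedNodes D t₀ R) :
    ∀ v ∈ G.nodes, ∃ ρ ∈ R, ρ.id = v ∧ t₀ + D ≤ ρ.now := by
  obtain ⟨⟨ρ, hρ, hρD⟩, hcl⟩ := h
  refine TVG.forall_nodes_of_closed hG (hR ρ hρ).1 ⟨ρ, hρ, rfl, hρD⟩ ?_
  rintro u v ⟨ρ, hρ, rfl, hρD⟩ he
  obtain ⟨s, hs, hc⟩ := hD _ _ he t₀ ht₀
  obtain ⟨ρ', h1, h2, h3⟩ := hcl ρ hρ hρD v ⟨s, by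
    rw [(hR ρ hρ).2.2]
    exact ⟨hc.mem, hs.1, hs.2.trans hρD⟩⟩
  exact ⟨ρ', h1, h3, h2⟩

theorem detects_closedNodes {G : TVG} (hG : G.footprint.Connected) {D : ℝ}
    (hD : G.CrossBound D) : Detects G (closedNodes D) where
  sound t₀ ht₀ R hR h v hv :=
    let ⟨ρ, hρ, h1, _⟩ := closedNodes_sound hG hD ht₀ hR h v hv
    ⟨ρ, hρ, h1⟩
  live t₀ _ := by
    refine ⟨t₀ + D, fun R hR h => ⟨?_, fun ρ hρ _ v hv => ?_⟩⟩
    · obtain ⟨v, hv⟩ := G.nodes_nonempty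
      obtain ⟨ρ, hρ, -, h2⟩ := h v hv
      exact ⟨ρ, hρ, h2⟩
    · rw [(hR ρ hρ).2.2] at hv
      obtain ⟨ρ', h1, h2, h3⟩ := h v
        (TVG.IsEdge.right_mem (u := ρ.id) (hv.mono inter_subset_left))
      exact ⟨ρ', h1, h3, h2⟩

/-! ### Executions of gossip protocols: spreading of records and termination detection -/

section Gossip

variable {G : TVG} {x : ℕ} {t₀ : ℝ} {τ : ℝ} {act : View (Set Rec) → Prop}
  {cmp : ℝ → Set Rec → Prop} {s : Sends (Set Rec)}

open Classical in
theorem gossip_send_eq_some {V : View (Set Rec)} {v : ℕ} {m : Message (Set Rec)} :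
    (gossip τ act cmp).send V v = some m ↔
      V.fires τ act v ∧ m = ⟨decide (act V), V.records⟩ := by
  unfold gossip
  by_cases h : V.fires τ act v
  · simp [h, eq_comm]
  · simp [h]

open Classical in
theorem gossip_sends (hs : (gossip τ act cmp).IsExecution G x t₀ s) {u v : ℕ} {t : ℝ}
    (ht : t₀ ≤ t) (hp : t ∈ G.present u v) (hf : (viewAt G x t₀ s u t).fires τ act v) :
    s u v t = some ⟨decide (act (viewAt G x t₀ s u t)), (viewAt G x t₀ s u t).records⟩ := by
  rw [hs.send_eq ht hp]
  exact gossip_send_eq_some.2 ⟨hf, rfl⟩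

open Classical in
theorem gossip_of_eq_some (hs : (gossip τ act cmp).IsExecution G x t₀ s) {u v : ℕ} {t : ℝ}
    {m : Message (Set Rec)} (h : s u v t = some m) :
    t₀ ≤ t ∧ t ∈ G.present u v ∧ (viewAt G x t₀ s u t).fires τ act v ∧
      m = ⟨decide (act (viewAt G x t₀ s u t)), (viewAt G x t₀ s u t).records⟩ := by
  obtain ⟨h1, h2, h3⟩ := hs.of_eq_some h
  obtain ⟨h4, h5⟩ := gossip_send_eq_some.1 h3
  exact ⟨h1, h2, h4, h5⟩

theorem gossip_emits_iff (hs : (gossip τ act cmp).IsExecution G x t₀ s) {u v : ℕ} {t : ℝ} :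
    ((gossip τ act cmp).trace G x t₀ s).emits u v t ↔
      t₀ ≤ t ∧ t ∈ G.present u v ∧ (viewAt G x t₀ s u t).fires τ act v ∧
        act (viewAt G x t₀ s u t) := by
  constructor
  · rintro ⟨m, hm, hi⟩
    obtain ⟨h1, h2, h3, rfl⟩ := gossip_of_eq_some hs hm
    exact ⟨h1, h2, h3, by simpa using hi⟩
  · rintro ⟨h1, h2, h3, h4⟩
    exact ⟨_, gossip_sends hs h1 h2 h3, by simpa using h4⟩

/-- At `t₀` itself nothing earlier has been observed, and every present edge seems to appear; later,
`ε` is cut down to `t - t₀`. -/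
theorem viewAt_appears_iff {M : Type} {s : Sends M} {u v : ℕ} {t : ℝ} (ht : t₀ < t) :
    (viewAt G x t₀ s u t).appears v ↔ G.Appears u v t := by
  constructor
  · rintro ⟨h1, ε, hε, h2⟩
    refine ⟨h1.1, min ε (t - t₀), lt_min hε (by linarith), fun r hr hrt hp => ?_⟩
    have h3 := min_le_left ε (t - t₀)
    have h4 := min_le_right ε (t - t₀)
    exact h2 r (show t - ε < r by linarith) hrt ⟨hp, by linarith, hrt.le⟩
  · rintro ⟨h1, ε, hε, h2⟩
    exact ⟨⟨h1, ht.le, le_rfl⟩, ε, hε, fun r hr hrt hp => h2 r hr hrt hp.1⟩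

/-- Ticks and appearances are separated, and at most one date is the first at which `act` holds. The
date `t₀` is added for the apparent appearances there. -/
theorem gossip_finite (hτ : 0 < τ) (hs : (gossip τ act cmp).IsExecution G x t₀ s) (u v : ℕ)
    (t : ℝ) : {r | r ≤ t ∧ s u v r ≠ none}.Finite := by
  have hsingle : {r | t₀ ≤ r ∧ act (viewAt G x t₀ s u r) ∧
      ∀ r', t₀ ≤ r' → r' < r → ¬ act ((viewAt G x t₀ s u r).truncate r')}.Finite := by
    refine Set.Subsingleton.finite ?_
    have key : ∀ r r', t₀ ≤ r → r < r' → act (viewAt G x t₀ s u r) →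
        ¬ ∀ q, t₀ ≤ q → q < r' → ¬ act ((viewAt G x t₀ s u r').truncate q) := by
      intro r r' h1 h2 h3 h4
      refine h4 r h1 h2 ?_
      rw [viewAt_truncate h2.le]
      exact h3
    rintro r ⟨h1, h2, h3⟩ r' ⟨h1', h2', h3'⟩
    rcases lt_trichotomy r r' with h | h | h
    · exact absurd h3' (key r r' h1 h h2)
    · exact h
    · exact absurd h3 (key r' r h1' h h2')
  refine (((finite_ticks hτ t₀ t).union ((TVG.finite_appears (G := G) (u := u) (v := v) t).union
    (finite_singleton t₀))).union hsingle).subset ?_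
  rintro r ⟨hrt, hr⟩
  obtain ⟨m, hm⟩ := Option.ne_none_iff_exists'.1 hr
  obtain ⟨h1, h2, h3, -⟩ := gossip_of_eq_some hs hm
  rcases h3 with h3 | h3 | h3
  · exact .inl (.inl ⟨hrt, h3⟩)
  · rcases h1.eq_or_lt with h | h
    · exact .inl (.inr (.inr h.symm))
    · exact .inl (.inr (.inl ⟨hrt, (viewAt_appears_iff h).1 h3⟩))
  · exact .inr ⟨h1, h3⟩

theorem gossip_solves (hτ : 0 < τ) {P : Problem}
    (h : ∀ x ∈ G.nodes, ∀ t₀, 0 ≤ t₀ → ∀ s, (gossip τ act cmp).IsExecution G x t₀ s →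
      P G x t₀ ((gossip τ act cmp).trace G x t₀ s)) :
    (gossip τ act cmp).Solves P G := fun x hx t₀ ht₀ =>
  ⟨Protocol.exists_isExecution _ _ _ _, fun s hs => ⟨gossip_finite hτ hs, h x hx t₀ ht₀ s hs⟩⟩

theorem gossip_exists_isLeast (hτ : 0 < τ) (hs : (gossip τ act cmp).IsExecution G x t₀ s) {v : ℕ}
    (hne : (receptions G ((gossip τ act cmp).trace G x t₀ s) x v).Nonempty) :
    ∃ r, IsLeast (receptions G ((gossip τ act cmp).trace G x t₀ s) x v) r :=
  exists_isLeast_of_finite_below hne (finite_receptions (gossip_finite hτ hs) v)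

/-- If a node fires at `a`, and an edge is crossable at `t ≥ a`, then the node fires
between `a` and `t` at some date when the edge is crossable. -/
theorem exists_fires {u v : ℕ} {a t : ℝ} (ha : t₀ ≤ a)
    (hf : (viewAt G x t₀ s u a).fires τ act v) (hat : a ≤ t) (hc : G.Crossable u v t) :
    ∃ r, a ≤ r ∧ r ≤ t ∧ G.Crossable u v r ∧ (viewAt G x t₀ s u r).fires τ act v := by
  -- Let `b` be the start of the current presence. If `b ≤ a` the edge is already usable at `a`;
  -- otherwise its appearance at `b` triggers a message.
  obtain ⟨b, hbt, hap, hcr⟩ := hc.exists_appears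
  rcases le_or_gt b a with h | h
  · exact ⟨a, le_rfl, hat, hcr a ⟨h, hat⟩, hf⟩
  · exact ⟨b, h.le, hbt, hap.crossable, .inr (.inl ((viewAt_appears_iff (ha.trans_lt h)).2 hap))⟩

theorem fires_tick {u v : ℕ} (k : ℕ) : (viewAt G x t₀ s u (t₀ + k * τ)).fires τ act v :=
  .inl ⟨k, rfl⟩

/-- After any date, a message is sent through any given edge. -/
theorem gossip_exists_crossing (hτ : 0 < τ) (ht₀ : 0 ≤ t₀) (hG : G.Recurring)  {u v : ℕ}
    (he : G.IsEdge u v) (a : ℝ) :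
    ∃ r, t₀ ≤ r ∧ a ≤ r ∧ G.Crossable u v r ∧ (viewAt G x t₀ s u r).fires τ act v := by
  obtain ⟨k, hk⟩ := exists_nat_gt ((a - t₀) / τ)
  rw [div_lt_iff₀ hτ] at hk
  have h0 : t₀ ≤ t₀ + k * τ := by
    have : (0 : ℝ) ≤ k * τ := by positivity
    linarith
  obtain ⟨t, ht, hc⟩ := hG u v he (t₀ + k * τ) (by linarith)
  obtain ⟨r, h1, -, h2, h3⟩ := exists_fires h0 (fires_tick (x := x) (s := s) (act := act) k) ht hc
  exact ⟨r, by linarith, by linarith, h2, h3⟩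

theorem records_mono {u : ℕ} {t t' : ℝ} (h : t ≤ t') :
    (viewAt G x t₀ s u t).records ⊆ (viewAt G x t₀ s u t').records := by
  rintro ρ (⟨r, h1, h2, h3⟩ | ⟨w, r, m, h1, h2⟩)
  · have h2' : r ≤ t := h2
    refine .inl ⟨r, h1, h2'.trans h, ?_⟩
    rw [h3, viewAt_truncate h2', viewAt_truncate (h2'.trans h)]
  · rw [received_eq_some] at h1
    exact .inr ⟨w, r, m, received_eq_some.2 ⟨h1.1.trans h, h1.2⟩, h2⟩

theorem record_mem_records {u : ℕ} {t t' : ℝ} (h0 : t₀ ≤ t) (h : t ≤ t') :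
    (viewAt G x t₀ s u t).record ∈ (viewAt G x t₀ s u t').records :=
  .inl ⟨t, h0, h, by rw [viewAt_truncate h]⟩

/-- Every record eventually reaches every node. -/
theorem gossip_spreads (hτ : 0 < τ) (ht₀ : 0 ≤ t₀) (hconn : G.footprint.Connected)
    (hG : G.Recurring) (hs : (gossip τ act cmp).IsExecution G x t₀ s) {u v : ℕ}
    (hu : u ∈ G.nodes) (hv : v ∈ G.nodes) {t : ℝ} (ht : t₀ ≤ t) :
    ∃ t', (viewAt G x t₀ s u t).record ∈ (viewAt G x t₀ s v t').records := by
  revert v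
  change ∀ v ∈ G.nodes, _
  refine TVG.forall_nodes_of_closed hconn hu ⟨t, record_mem_records ht le_rfl⟩ ?_
  rintro v w ⟨t', ht'⟩ he
  obtain ⟨r, h1, h2, h3, h4⟩ := gossip_exists_crossing (x := x) (s := s) (act := act) hτ ht₀ hG he t'
  exact ⟨r + G.ζ, .inr ⟨v, r + G.ζ, _, received_eq_some.2 ⟨le_rfl, by simpa using h3, by
    simpa using gossip_sends hs h1 h3.mem h4⟩, records_mono h2 ht'⟩⟩

theorem gossip_spreads_all (hτ : 0 < τ) (ht₀ : 0 ≤ t₀) (hconn : G.footprint.Connected)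
    (hG : G.Recurring) (hs : (gossip τ act cmp).IsExecution G x t₀ s) {v : ℕ}
    (hv : v ∈ G.nodes) {t : ℝ} (ht : t₀ ≤ t) :
    ∃ T, ∀ t' ≥ T, ∀ u ∈ G.nodes,
      (viewAt G x t₀ s u t).record ∈ (viewAt G x t₀ s v t').records := by
  have : ∀ u, ∃ t', u ∈ G.nodes →
      (viewAt G x t₀ s u t).record ∈ (viewAt G x t₀ s v t').records := by
    intro u
    by_cases hu : u ∈ G.nodes
    · obtain ⟨t', h⟩ := gossip_spreads hτ ht₀ hconn hG hs hu hv ht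
      exact ⟨t', fun _ => h⟩
    · exact ⟨0, fun h => absurd h hu⟩
  choose f hf using this
  obtain ⟨T, hT⟩ := (G.nodes.finite_toSet.image f).bddAbove
  exact ⟨T, fun t' ht' u hu => records_mono ((hT ⟨u, hu, rfl⟩).trans ht') (hf u hu)⟩

/-- Records are relayed unaltered, so each goes back, by induction on delays, to an actual past view
of a node. -/
theorem records_truthful (hs : (gossip τ act cmp).IsExecution G x t₀ s) {t : ℝ} (ht : t₀ ≤ t) :
    ∀ u ∈ G.nodes, ∀ ρ ∈ (viewAt G x t₀ s u t).records,
      ∃ v ∈ G.nodes, ∃ r, t₀ ≤ r ∧ r ≤ t ∧ ρ = (viewAt G x t₀ s v r).record := by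
  refine delay_induction (P := fun t => ∀ u ∈ G.nodes, ∀ ρ ∈ (viewAt G x t₀ s u t).records,
      ∃ v ∈ G.nodes, ∃ r, t₀ ≤ r ∧ r ≤ t ∧ ρ = (viewAt G x t₀ s v r).record) G.ζ_pos ?_ ht
  rintro t ht ih u hu ρ (⟨r, h1, h2, h3⟩ | ⟨w, r, m, h1, h2⟩)
  · refine ⟨u, hu, r, h1, h2, ?_⟩
    rw [h3, viewAt_truncate (show r ≤ t from h2)]
  · obtain ⟨h3, h4, h5⟩ := received_eq_some.1 h1
    obtain ⟨h6, -, -, rfl⟩ := gossip_of_eq_some hs h5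
    obtain ⟨v, hv, r', h7, h8, h9⟩ := ih (r - G.ζ) h6 (by linarith) w h4.isEdge.left_mem ρ h2
    exact ⟨v, hv, r', h7, by linarith [G.ζ_pos], h9⟩

theorem truthful_records (hs : (gossip τ act cmp).IsExecution G x t₀ s) {t : ℝ} (ht : t₀ ≤ t)
    {u : ℕ} (hu : u ∈ G.nodes) : Truthful G t₀ (viewAt G x t₀ s u t).records := by
  intro ρ hρ
  obtain ⟨v, hv, r, h1, h2, rfl⟩ := records_truthful hs ht u hu ρ hρ
  exact ⟨hv, h1, fun w => rfl⟩

/-- The nodes hold the information when they should. -/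
theorem viewAt_holds_iff (hact : ∀ V, act V → V.holds)
    (hs : (gossip τ act cmp).IsExecution G x t₀ s) {u : ℕ} {t : ℝ} (ht : t₀ ≤ t) :
    (viewAt G x t₀ s u t).holds ↔
      u = x ∨ ∃ r ∈ receptions G ((gossip τ act cmp).trace G x t₀ s) x u, r ≤ t := by
  constructor
  · revert u
    change ∀ u, _
    refine delay_induction (P := fun t => ∀ u, (viewAt G x t₀ s u t).holds →
      u = x ∨ ∃ r ∈ receptions G ((gossip τ act cmp).trace G x t₀ s) x u, r ≤ t) G.ζ_pos ?_ ht
    rintro t ht ih u (h | ⟨w, r, m, h1, h2⟩)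
    · exact .inl h
    · right
      obtain ⟨h3, h4, h5⟩ := received_eq_some.1 h1
      have h5' := h5
      obtain ⟨h6, -, -, rfl⟩ := gossip_of_eq_some hs h5'
      -- By `hact` the sender of an information message holds the information, so by induction an
      -- information journey has reached it or it is the emitter.
      have h7 := ih (r - G.ζ) h6 (by linarith) w (hact _ (by simpa using h2))
      refine ⟨r, ?_, h3⟩
      have := mem_receptions_of_emits (T := (gossip τ act cmp).trace G x t₀ s) ⟨_, h5, h2⟩ h4 h7
      simpa using this
  · rintro (h | ⟨r, hr, hrt⟩)
    · exact .inl h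
    · obtain ⟨w, t', ⟨m, hm, hi⟩, hc, rfl, -⟩ := mem_receptions hr
      exact .inr ⟨w, t' + G.ζ, m, received_eq_some.2 ⟨hrt, by simpa using hc, by rw [add_sub_cancel_right]; exact hm⟩, hi⟩

/-- Termination detection: if all nodes get the information, the emitter eventually knows. -/
theorem gossip_TDB (hτ : 0 < τ) (hact : ∀ V, act V → V.holds) (ht₀ : 0 ≤ t₀)
    (hx : x ∈ G.nodes) (hconn : G.footprint.Connected) (hG : G.Recurring)
    (hcmp : Detects G cmp) (hs : (gossip τ act cmp).IsExecution G x t₀ s)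
    (hall : ∀ v ∈ G.nodes, v ≠ x →
      (receptions G ((gossip τ act cmp).trace G x t₀ s) x v).Nonempty) :
    TDB G x t₀ ((gossip τ act cmp).trace G x t₀ s) := by
  refine ⟨?_, ?_⟩
  · have hinf : ∃ T, ∀ v ∈ G.nodes, ∀ t ≥ T, t₀ ≤ t → (viewAt G x t₀ s v t).holds := by
      have : ∀ v, ∃ T, v ∈ G.nodes → ∀ t ≥ T, t₀ ≤ t → (viewAt G x t₀ s v t).holds := by
        intro v
        by_cases hv : v ∈ G.nodes ∧ v ≠ x
        · obtain ⟨r, hr⟩ := hall v hv.1 hv.2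
          exact ⟨r, fun _ t ht h0 => (viewAt_holds_iff hact hs h0).2 (.inr ⟨r, hr, ht⟩)⟩
        · refine ⟨0, fun hv' t _ h0 => (viewAt_holds_iff hact hs h0).2 (.inl ?_)⟩
          by_contra h
          exact hv ⟨hv', h⟩
      choose f hf using this
      obtain ⟨T, hT⟩ := (G.nodes.finite_toSet.image f).bddAbove
      exact ⟨T, fun v hv t ht => hf v hv t ((hT ⟨v, hv, rfl⟩).trans ht)⟩
    obtain ⟨T₁, hT₁⟩ := hinf
    obtain ⟨D, hD⟩ := hcmp.live t₀ ht₀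
    -- By `T` all nodes are informed and records are late enough for the test; those made at `T` all
    -- reach the emitter by `T'`.
    let T := max t₀ (max T₁ D)
    have hT0 : t₀ ≤ T := le_max_left _ _
    obtain ⟨T', hT'⟩ := gossip_spreads_all hτ ht₀ hconn hG hs hx hT0
    have h0 : t₀ ≤ max t₀ T' := le_max_left _ _
    refine ⟨max t₀ T', max t₀ T', le_rfl, h0, hD _ ?_ ?_⟩
    · exact fun ρ hρ => truthful_records hs h0 hx ρ hρ.1
    · intro v hv
      refine ⟨_, ⟨hT' _ (le_max_right _ _) v hv, hT₁ v hv T ?_ hT0⟩, rfl, ?_⟩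
      · exact (le_max_left _ _).trans (le_max_right _ _)
      · exact (le_max_right _ _).trans (le_max_right _ _)
  · rintro t ⟨t', ht't, ht', hh⟩ v hv hvx
    obtain ⟨ρ, ⟨hρ, hi⟩, rfl⟩ := hcmp.sound t₀ ht₀ _
      (fun ρ hρ => truthful_records hs ht' hx ρ hρ.1) hh v hv
    obtain ⟨w, hw, r, h1, h2, rfl⟩ := records_truthful hs ht' x hx ρ hρ
    rcases (viewAt_holds_iff hact hs h1).1 hi with h | ⟨r', hr', hrr'⟩
    · exact absurd h hvx
    · exact ⟨r', by linarith, hr'⟩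

end Gossip

/-! ### Flooding and foremost broadcast -/

theorem exists_journey {G : TVG} (hconn : G.footprint.Connected) (hG : G.Recurring) {x v : ℕ}
    (hx : x ∈ G.nodes) (hv : v ∈ G.nodes) (hvx : v ≠ x) {t : ℝ} (ht : 0 ≤ t) :
    ∃ k d a, t ≤ d ∧ G.HasJourney x v k d a := by
  refine (TVG.forall_nodes_of_closed hconn (P := fun v => v = x ∨
    ∃ k d a, t ≤ d ∧ G.HasJourney x v k d a) hx (.inl rfl) ?_ v hv).resolve_left hvx
  rintro u w (rfl | ⟨k, d, a, h1, h2⟩) he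
  · obtain ⟨s, hs, hc⟩ := hG u w he t ht
    exact .inr ⟨1, s, _, hs, .single hc⟩
  · have := h2.lt G.ζ_pos
    obtain ⟨s, hs, hc⟩ := hG u w he a (by linarith)
    exact .inr ⟨k + 1, d, _, h1, .snoc h2 hs hc⟩

section Flooding

variable {G : TVG} {x : ℕ} {t₀ : ℝ} {τ : ℝ} {act : View (Set Rec) → Prop}
  {cmp : ℝ → Set Rec → Prop} {s : Sends (Set Rec)}

/-- A node that is active exactly from date `a` on fires at date `a`. -/
theorem fires_of_act {u v : ℕ} {a : ℝ} (ha : t₀ ≤ a)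
    (hact : ∀ t, t₀ ≤ t → (act (viewAt G x t₀ s u t) ↔ a ≤ t)) :
    (viewAt G x t₀ s u a).fires τ act v := by
  refine .inr (.inr ⟨(hact a ha).2 le_rfl, fun t' h0 h1 => ?_⟩)
  have h1' : t' < a := h1
  rw [viewAt_truncate h1'.le, hact t' h0]
  exact not_le.2 h1'

/-- A node that is active exactly from date `a` on passes the information on through each edge
that is crossable at some later date, at that date or before. -/
theorem exists_reception_of_act (hs : (gossip τ act cmp).IsExecution G x t₀ s) {u v : ℕ} {a t : ℝ}
    (ha : t₀ ≤ a) (hact : ∀ t, t₀ ≤ t → (act (viewAt G x t₀ s u t) ↔ a ≤ t))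
    (hu : u = x ∨ ∃ r ∈ receptions G ((gossip τ act cmp).trace G x t₀ s) x u, r ≤ a)
    (hat : a ≤ t) (hc : G.Crossable u v t) :
    ∃ r ∈ receptions G ((gossip τ act cmp).trace G x t₀ s) x v, r ≤ t + G.ζ := by
  obtain ⟨r, h1, h2, h3, h4⟩ := exists_fires ha (fires_of_act ha hact) hat hc
  have he := (gossip_emits_iff hs (v := v)).2
    ⟨ha.trans h1, h3.mem, h4, (hact r (ha.trans h1)).2 h1⟩
  refine ⟨_, mem_receptions_of_emits he h3 (hu.imp id ?_), by linarith⟩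
  rintro ⟨b, hb, hba⟩
  exact ⟨b, hb, hba.trans h1⟩

/-- Flooding from date `e` on is as fast as any journey that departs from date `e` on. -/
theorem flooding_le_journey (hτ : 0 < τ) (hactholds : ∀ V, act V → V.holds)
    (hs : (gossip τ act cmp).IsExecution G x t₀ s) {e : ℝ} (he : t₀ ≤ e)
    (hactx : ∀ t, t₀ ≤ t → (act (viewAt G x t₀ s x t) ↔ e ≤ t))
    (hact : ∀ u ≠ x, ∀ t, t₀ ≤ t → (act (viewAt G x t₀ s u t) ↔ (viewAt G x t₀ s u t).holds))
    {v k : ℕ} {d a : ℝ} (hd : e ≤ d) (hj : G.HasJourney x v k d a) :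
    ∃ r ∈ receptions G ((gossip τ act cmp).trace G x t₀ s) x v, r ≤ a := by
  have hζ := G.ζ_pos
  induction hj with
  | single hc => exact exists_reception_of_act hs he hactx (.inl rfl) hd hc
  | @snoc u w k d a t j hat hc ih =>
    have hda := Journey.lt hζ j
    by_cases hux : u = x
    · subst hux
      exact exists_reception_of_act hs he hactx (.inl rfl) (by linarith) hc
    · obtain ⟨b, hb, hba⟩ := ih hd
      -- The node `u` is active exactly from its first reception `r` on, and `r` is no later than
      -- the arrival of the given journey at `u`.
      obtain ⟨r, hr, hmin⟩ := gossip_exists_isLeast hτ hs ⟨b, hb⟩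
      have hr0 : t₀ ≤ r := by
        obtain ⟨k, d, hj⟩ := hr
        exact (hs.le_of_mem_receptions hj).trans (Journey.lt hζ hj).le
      refine exists_reception_of_act hs hr0 (fun t ht => ?_) (.inr ⟨r, hr, le_rfl⟩)
        ((hmin hb).trans (hba.trans hat)) hc
      rw [hact u hux t ht, viewAt_holds_iff hactholds hs ht]
      constructor
      · rintro (h | ⟨q, hq, hqt⟩)
        · exact absurd h hux
        · exact (hmin hq).trans hqt
      · exact fun h => .inr ⟨r, hr, h⟩

/-- Flooding solves foremost broadcast. -/
theorem gossip_solves_foremost (hconn : G.footprint.Connected) (hG : G.Recurring)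
    (hcmp : Detects G cmp) : (gossip 1 View.holds cmp).Solves TDBforemost G := by
  refine gossip_solves one_pos fun x hx t₀ ht₀ s hs => ?_
  have hflood : ∀ {v k : ℕ} {d a : ℝ}, t₀ ≤ d → G.HasJourney x v k d a →
      ∃ r ∈ receptions G ((gossip 1 View.holds cmp).trace G x t₀ s) x v, r ≤ a :=
    fun hd hj => flooding_le_journey one_pos (fun _ h => h) hs le_rfl
      (fun t ht => ⟨fun _ => ht, fun _ => .inl rfl⟩) (fun _ _ _ _ => Iff.rfl) hd hj
  have hne : ∀ v ∈ G.nodes, v ≠ x →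
      (receptions G ((gossip 1 View.holds cmp).trace G x t₀ s) x v).Nonempty := by
    intro v hv hvx
    obtain ⟨k, d, a, h1, h2⟩ := exists_journey hconn hG hx hv hvx ht₀
    obtain ⟨r, hr, -⟩ := hflood h1 h2
    exact ⟨r, hr⟩
  refine ⟨gossip_TDB one_pos (fun _ h => h) ht₀ hx hconn hG hcmp hs hne, fun v hv hvx => ?_⟩
  obtain ⟨r, hr, hmin⟩ := gossip_exists_isLeast one_pos hs (hne v hv hvx)
  refine ⟨r, hr, ?_, ?_⟩
  · obtain ⟨k, d, hj⟩ := hr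
    exact ⟨k, d, hs.le_of_mem_receptions hj, hj.hasJourney⟩
  · rintro a ⟨k, d, hd, hj⟩
    obtain ⟨r', hr', hle⟩ := hflood hd hj
    exact (hmin hr').trans hle

end Flooding

/-! ### Shortest broadcast -/

/-- `v` is at most `j` hops away from `x` in the footprint. -/
def TVG.Within (G : TVG) (x : ℕ) : ℕ → ℕ → Prop
  | 0, v => v = x
  | j + 1, v => G.Within x j v ∨ ∃ w, G.Within x j w ∧ G.IsEdge w v

namespace TVG

variable {G : TVG} {x v : ℕ}

theorem Within.mono {i j : ℕ} (hij : i ≤ j) (h : G.Within x i v) : G.Within x j v := by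
  induction j, hij using Nat.le_induction with
  | base => exact h
  | succ j _ ih => exact .inl ih

theorem HasJourney.within {k : ℕ} {d a : ℝ} (h : G.HasJourney x v k d a) : G.Within x k v := by
  induction h with
  | single h => exact .inr ⟨x, rfl, h.isEdge⟩
  | snoc _ _ h ih => exact .inr ⟨_, ih, h.isEdge⟩

theorem exists_within (hconn : G.footprint.Connected) (hx : x ∈ G.nodes) (hv : v ∈ G.nodes) :
    ∃ j, G.Within x j v :=
  forall_nodes_of_closed hconn (P := fun v => ∃ j, G.Within x j v) hx ⟨0, rfl⟩
    (fun _ _ ⟨j, hj⟩ he => ⟨j + 1, .inr ⟨_, hj, he⟩⟩) v hv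

end TVG

/-- In phase `k`, of length `D`, starting at tick `k` (with ticks `T` apart), the active nodes are
those informed after tick `k - 1` and by tick `k`. -/
def phaseActive (D T : ℝ) (V : View (Set Rec)) : Prop :=
  V.holds ∧ ∃ k : ℕ, V.start + k * T ≤ V.now ∧ V.now ≤ V.start + k * T + D ∧
    (V.truncate (V.start + k * T)).holds ∧
    ∀ j < k, ¬ (V.truncate (V.start + j * T)).holds

section Shortest

variable {G : TVG} {x : ℕ} {t₀ D T : ℝ} {cmp : ℝ → Set Rec → Prop} {s : Sends (Set Rec)}

theorem phaseActive_holds (V : View (Set Rec)) (h : phaseActive D T V) : V.holds := h.1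

theorem tick_le (hT : 0 ≤ T) (k : ℕ) : t₀ ≤ t₀ + k * T := by
  have : (0 : ℝ) ≤ k * T := by positivity
  linarith

theorem tick_mono (hT : 0 ≤ T) {j k : ℕ} (h : j ≤ k) : t₀ + j * T ≤ t₀ + k * T := by
  have : (j : ℝ) ≤ k := by exact_mod_cast h
  nlinarith

/-- Activity in terms of what the node knew at the ticks. -/
theorem phaseActive_iff (hT : 0 < T) (hs : (gossip T (phaseActive D T) cmp).IsExecution G x t₀ s)
    {u : ℕ} {t : ℝ} : phaseActive D T (viewAt G x t₀ s u t) ↔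
      ∃ k : ℕ, t₀ + k * T ≤ t ∧ t ≤ t₀ + k * T + D ∧
        (viewAt G x t₀ s u (t₀ + k * T)).holds ∧
        ∀ j < k, ¬ (viewAt G x t₀ s u (t₀ + j * T)).holds := by
  constructor
  · rintro ⟨-, k, h1, h2, h3, h4⟩
    have h1' : t₀ + k * T ≤ t := h1
    refine ⟨k, h1, h2, ?_, fun j hj => ?_⟩
    · have : (viewAt G x t₀ s u t).start = t₀ := rfl
      rwa [this, viewAt_truncate h1'] at h3
    · have := h4 j hj
      have h' : (viewAt G x t₀ s u t).start = t₀ := rfl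
      rwa [h', viewAt_truncate ((tick_mono hT.le hj.le).trans h1')] at this
  · rintro ⟨k, h1, h2, h3, h4⟩
    refine ⟨?_, k, h1, h2, ?_, fun j hj => ?_⟩
    · rw [viewAt_holds_iff phaseActive_holds hs (tick_le hT.le k)] at h3
      rw [viewAt_holds_iff phaseActive_holds hs ((tick_le hT.le k).trans h1)]
      exact h3.imp id fun ⟨r, hr, hrt⟩ => ⟨r, hr, hrt.trans h1⟩
    · change ((viewAt G x t₀ s u t).truncate (t₀ + k * T)).holds
      rwa [viewAt_truncate h1]
    · change ¬ ((viewAt G x t₀ s u t).truncate (t₀ + j * T)).holds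
      rw [viewAt_truncate ((tick_mono hT.le hj.le).trans h1)]
      exact h4 j hj

variable (hD : G.CrossBound D) (hD0 : 0 ≤ D) (hT : T = D + G.ζ) (ht₀ : 0 ≤ t₀)
  (hs : (gossip T (phaseActive D T) cmp).IsExecution G x t₀ s)

include hD0 hT hs in
/-- A message received by tick `j + 1` was sent in phase `j` or before. -/
theorem sender_of_reception {v : ℕ} {r : ℝ}
    (hr : r ∈ receptions G ((gossip T (phaseActive D T) cmp).trace G x t₀ s) x v) :
    ∃ w t, ∃ k : ℕ, r = t + G.ζ ∧ G.Crossable w v t ∧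
      ((gossip T (phaseActive D T) cmp).trace G x t₀ s).emits w v t ∧
      t₀ + k * T ≤ t ∧ (viewAt G x t₀ s w (t₀ + k * T)).holds ∧
      (∀ j < k, ¬ (viewAt G x t₀ s w (t₀ + j * T)).holds) ∧
      ∀ j : ℕ, r ≤ t₀ + (j + 1 : ℕ) * T → k ≤ j := by
  have hζ := G.ζ_pos
  have hTpos : 0 < T := by linarith
  obtain ⟨w, t, he, hc, rfl, -⟩ := mem_receptions hr
  have he' := he
  obtain ⟨k, h1, h2, h3, h4⟩ := (phaseActive_iff hTpos hs).1 ((gossip_emits_iff hs).1 he').2.2.2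
  refine ⟨w, t, k, rfl, hc, he, h1, h3, h4, fun j hj => ?_⟩
  by_contra! hjk
  have := tick_mono (t₀ := t₀) hTpos.le hjk
  linarith

include hD hD0 hT ht₀ hs in
/-- The nodes informed by tick `j` are those at most `j` hops away. -/
theorem holds_tick_iff (j : ℕ) : ∀ v,
    (viewAt G x t₀ s v (t₀ + j * T)).holds ↔ G.Within x j v := by
  have hζ := G.ζ_pos
  have hTpos : 0 < T := by linarith
  have hle := fun k : ℕ => tick_le (t₀ := t₀) hTpos.le k
  induction j using Nat.strong_induction_on with
  | _ j ih =>
  intro v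
  rw [viewAt_holds_iff phaseActive_holds hs (hle j)]
  cases j with
  | zero =>
    refine ⟨fun h => h.resolve_right ?_, .inl⟩
    rintro ⟨r, ⟨k, d, hr⟩, hrt⟩
    have := hs.le_of_mem_receptions hr
    have := Journey.lt hζ hr
    simp only [Nat.cast_zero, zero_mul, add_zero] at hrt
    linarith
  | succ j =>
    constructor
    · rintro (rfl | ⟨r, hr, hrt⟩)
      · exact TVG.Within.mono (Nat.zero_le _) rfl
      · obtain ⟨w, t, k, -, hc, -, -, h1, -, h2⟩ := sender_of_reception hD0 hT hs hr
        have hk := h2 j hrt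
        exact .inr ⟨w, ((ih k (by omega) w).1 h1).mono hk, hc.isEdge⟩
    · intro hv
      by_cases hv' : G.Within x j v
      · rw [← ih j (by omega), viewAt_holds_iff phaseActive_holds hs (hle j)] at hv'
        exact hv'.imp id fun ⟨r, hr, hrt⟩ =>
          ⟨r, hr, hrt.trans (tick_mono hTpos.le (Nat.le_succ j))⟩
      -- Here `v` is exactly `j + 1` hops away, so its neighbour `w` is exactly `j` hops away and
      -- active during phase `j`, which is long enough for the edge to become crossable.
      · obtain ⟨w, hw, he⟩ := hv.resolve_left hv'
        obtain ⟨c, hc1, hc⟩ := hD w v he (t₀ + j * T) (ht₀.trans (hle j))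
        obtain ⟨r, h1, h2, h3, h4⟩ := exists_fires (x := x) (s := s) (act := phaseActive D T)
          (hle j) (fires_tick j) hc1.1 hc
        have hwh := (ih j (by omega) w).2 hw
        have hact : phaseActive D T (viewAt G x t₀ s w r) := by
          refine (phaseActive_iff hTpos hs).2 ⟨j, h1, h2.trans hc1.2, hwh, fun i hi hh => hv' ?_⟩
          refine TVG.Within.mono (i := i + 1) (by omega) (.inr ⟨w, ?_, he⟩)
          exact (ih i (by omega) w).1 hh
        have hem := (gossip_emits_iff hs (v := v)).2 ⟨(hle j).trans h1, h3.mem, h4, hact⟩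
        refine .inr ⟨_, mem_receptions_of_emits hem h3 ?_, ?_⟩
        · rw [viewAt_holds_iff phaseActive_holds hs (hle j)] at hwh
          exact hwh.imp id fun ⟨q, hq, hqt⟩ => ⟨q, hq, hqt.trans h1⟩
        -- The last `ζ` of a phase of length `T = D + ζ` lets the messages arrive by the next tick.
        · push_cast
          linarith [hc1.2]

include hD hD0 hT ht₀ hs in
/-- The information received by a node `j` hops away by tick `j` has travelled `j` hops. -/
theorem infoJourney_of_phase (j : ℕ) : ∀ v r, ¬ G.Within x j v → G.Within x (j + 1) v →
    r ∈ receptions G ((gossip T (phaseActive D T) cmp).trace G x t₀ s) x v →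
    r ≤ t₀ + (j + 1 : ℕ) * T →
    ∃ d, InfoJourney G ((gossip T (phaseActive D T) cmp).trace G x t₀ s) x v (j + 1) d r := by
  have hζ := G.ζ_pos
  have hTpos : 0 < T := by linarith
  have hle := fun k : ℕ => tick_le (t₀ := t₀) hTpos.le k
  have hiff := holds_tick_iff hD hD0 hT ht₀ hs
  induction j with
  | zero =>
    intro v r hv hv' hr hrt
    obtain ⟨w, t, k, rfl, hc, he, -, h1, -, h2⟩ := sender_of_reception hD0 hT hs hr
    obtain rfl : k = 0 := by have := h2 0 hrt; omega
    obtain rfl : w = x := (hiff 0 w).1 h1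
    exact ⟨t, .single ⟨he, hc⟩⟩
  | succ j ih =>
    intro v r hv hv' hr hrt
    obtain ⟨w, t, k, rfl, hc, he, hkt, h1, h3, h2⟩ := sender_of_reception hD0 hT hs hr
    have hk := h2 (j + 1) hrt
    -- A sender active in an earlier phase would put `v` within `j + 1` hops. So the sender `w` is
    -- exactly `j + 1` hops away, and the induction hypothesis applies to its reception by tick `j +
    -- 1`.
    have hk' : k = j + 1 := by
      by_contra hne
      exact hv (TVG.Within.mono (i := k + 1) (by omega)
        (.inr ⟨w, (hiff k w).1 h1, hc.isEdge⟩))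
    subst hk'
    have hw : ¬ G.Within x j w := fun h => h3 j (by omega) ((hiff j w).2 h)
    have hwx : w ≠ x := by
      rintro rfl
      exact hw (TVG.Within.mono (Nat.zero_le _) rfl)
    obtain ⟨b, hb, hbt⟩ :=
      ((viewAt_holds_iff phaseActive_holds hs (hle (j + 1))).1 h1).resolve_left hwx
    obtain ⟨d, hj⟩ := ih w b hw ((hiff (j + 1) w).1 h1) hb hbt
    exact ⟨d, .snoc hj (hbt.trans hkt) ⟨he, hc⟩⟩

end Shortest

/-- Broadcast in phases solves shortest broadcast. -/
theorem gossip_solves_shortest {G : TVG} {D : ℝ} {cmp : ℝ → Set Rec → Prop}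
    (hconn : G.footprint.Connected) (hD : G.CrossBound D) (hD0 : 0 ≤ D) (hcmp : Detects G cmp) :
    (gossip (D + G.ζ) (phaseActive D (D + G.ζ)) cmp).Solves TDBshortest G := by
  have hζ := G.ζ_pos
  have hT : 0 < D + G.ζ := by linarith
  refine gossip_solves hT fun x hx t₀ ht₀ s hs => ?_
  have hlevel : ∀ v ∈ G.nodes, v ≠ x → ∃ j r,
      ¬ G.Within x j v ∧ G.Within x (j + 1) v ∧ r ≤ t₀ + (j + 1 : ℕ) * (D + G.ζ) ∧
      r ∈ receptions G ((gossip (D + G.ζ) (phaseActive D (D + G.ζ)) cmp).trace G x t₀ s) x v := by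
    intro v hv hvx
    classical
    have hex := TVG.exists_within hconn hx hv
    have hpos : Nat.find hex ≠ 0 := fun h => hvx (by
      have := Nat.find_spec hex
      rwa [h] at this)
    obtain ⟨j, hj⟩ := Nat.exists_eq_succ_of_ne_zero hpos
    have h1 := Nat.find_spec hex
    rw [hj] at h1
    have h3 := (holds_tick_iff hD hD0 rfl ht₀ hs (j + 1) v).2 h1
    obtain ⟨r, hr, hrt⟩ := ((viewAt_holds_iff phaseActive_holds hs
      (tick_le hT.le (j + 1))).1 h3).resolve_left hvx
    exact ⟨j, r, Nat.find_min hex (by omega), h1, hrt, hr⟩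
  refine ⟨gossip_TDB hT phaseActive_holds ht₀ hx hconn hD.recurring hcmp hs
    fun v hv hvx => ?_, fun v hv hvx => ?_⟩
  · obtain ⟨j, r, -, -, -, hr⟩ := hlevel v hv hvx
    exact ⟨r, hr⟩
  · obtain ⟨j, b, h1, h2, hbt, hb⟩ := hlevel v hv hvx
    obtain ⟨r, hr⟩ := gossip_exists_isLeast hT hs ⟨b, hb⟩
    obtain ⟨d, hj⟩ := infoJourney_of_phase hD hD0 rfl ht₀ hs j v r h1 h2 hr.1
      ((hr.2 hb).trans hbt)
    refine ⟨r, j + 1, d, hr, hj, ⟨d, r, hs.le_of_mem_receptions hj, hj.hasJourney⟩, ?_⟩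
    rintro k ⟨d', a, -, hk⟩
    by_contra! hlt
    exact h1 (TVG.HasJourney.within hk |>.mono (by omega))

/-! ### The minimal duration of a broadcast -/

namespace TVG

variable {G : TVG} {x : ℕ} {t₀ : ℝ}

/-- The windows within the time `[t₀, B]` during which there is a journey of `k + 1` hops. -/
def journeyWindows (G : TVG) (x : ℕ) (t₀ B : ℝ) (k v : ℕ) : Set (ℝ × ℝ) :=
  {q | t₀ ≤ q.1 ∧ q.2 ≤ B ∧ ∃ d a, q.1 ≤ d ∧ a ≤ q.2 ∧ G.HasJourney x v (k + 1) d a}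

/-- Induction on hops. With the date `t` of the last hop as an extra coordinate, the conditions on a
window `(e, b)` are closed: `(e, t)` is a window for the previous hops, and the last edge is
crossable at `t`. Projecting `t` away, and uniting over the finitely many nodes before the last,
preserves compactness. -/
theorem isCompact_journeyWindows (G : TVG) (x : ℕ) (t₀ B : ℝ) (k : ℕ) :
    ∀ v, IsCompact (G.journeyWindows x t₀ B k v) := by
  have hζ := G.ζ_pos
  have hbox : IsCompact ((Icc t₀ B ×ˢ Icc t₀ B) ×ˢ Icc t₀ B) :=
    (isCompact_Icc.prod isCompact_Icc).prod isCompact_Icc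
  have hcr : ∀ v w, IsClosed {z : (ℝ × ℝ) × ℝ | z.2 + G.ζ ≤ z.1.2 ∧ G.Crossable v w z.2} :=
    fun v w => (isClosed_le (f := fun z : (ℝ × ℝ) × ℝ => z.2 + G.ζ) (g := fun z => z.1.2)
      (by fun_prop) (by fun_prop)).inter ((G.isClosed_crossable v w).preimage continuous_snd)
  induction k with
  | zero =>
    intro v
    have h : G.journeyWindows x t₀ B 0 v = Prod.fst '' (((Icc t₀ B ×ˢ Icc t₀ B) ×ˢ Icc t₀ B) ∩
        ({z : (ℝ × ℝ) × ℝ | z.1.1 ≤ z.2} ∩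
          {z : (ℝ × ℝ) × ℝ | z.2 + G.ζ ≤ z.1.2 ∧ G.Crossable x v z.2})) := by
      ext q
      constructor
      · rintro ⟨h1, h2, d, a, h3, h4, hj⟩
        obtain ⟨hc, rfl⟩ := Journey.crossing_of_one hj
        exact ⟨(q, d), ⟨⟨⟨⟨h1, by linarith⟩, ⟨by linarith, h2⟩⟩, ⟨by linarith, by linarith⟩⟩,
          h3, h4, hc⟩, rfl⟩
      · rintro ⟨⟨q, t⟩, ⟨⟨⟨h1, h2⟩, h3⟩, h4, h5, h6⟩, rfl⟩
        exact ⟨h1.1, h2.2, t, _, h4, h5, .single h6⟩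
    rw [h]
    exact (hbox.inter_right ((isClosed_le (by fun_prop) (by fun_prop)).inter (hcr x v))).image
      continuous_fst
  | succ k ih =>
    intro w
    have h : G.journeyWindows x t₀ B (k + 1) w = ⋃ v ∈ G.nodes,
        Prod.fst '' (((Icc t₀ B ×ˢ Icc t₀ B) ×ˢ Icc t₀ B) ∩
        ((fun z : (ℝ × ℝ) × ℝ => (z.1.1, z.2)) ⁻¹' G.journeyWindows x t₀ B k v ∩
          {z : (ℝ × ℝ) × ℝ | z.2 + G.ζ ≤ z.1.2 ∧ G.Crossable v w z.2})) := by
      ext q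
      simp only [mem_iUnion]
      constructor
      · rintro ⟨h1, h2, d, a, h3, h4, hj⟩
        cases hj with
        | @snoc v _ _ _ a t hj hat hc =>
          have := hj.lt hζ
          exact ⟨v, hc.isEdge.left_mem, (q, t), ⟨⟨⟨⟨h1, by linarith⟩, ⟨by linarith, h2⟩⟩,
            ⟨by linarith, by linarith⟩⟩, ⟨h1, by simp only; linarith, d, a, h3, hat, hj⟩,
            h4, hc⟩, rfl⟩
      · rintro ⟨v, -, ⟨q, t⟩, ⟨⟨⟨h1, h2⟩, h3⟩, ⟨-, -, d, a, h4, h5, hj⟩, h6, h7⟩, rfl⟩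
        exact ⟨h1.1, h2.2, d, _, h4, h6, .snoc hj h5 h7⟩
    rw [h]
    exact G.nodes.finite_toSet.isCompact_biUnion fun v _ => (hbox.inter_right
      (((ih v).isClosed.preimage (by fun_prop)).inter (hcr v w))).image continuous_fst

theorem PeriodicWith.hasJourney_add_iff {p : ℝ} (hp : G.PeriodicWith p) (m : ℕ) {v k : ℕ}
    {d a : ℝ} (hd : 0 ≤ d) :
    G.HasJourney x v k (d + m * p) (a + m * p) ↔ G.HasJourney x v k d a := by
  constructor
  · intro h
    have := Journey.shift (C' := G.Crossable) h (-(m * p)) G.ζ_pos fun w w' t ht hc => by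
      rw [← hp.crossable_add_iff m (by linarith)]
      simpa using hc
    rwa [add_neg_cancel_right, add_neg_cancel_right] at this
  · exact fun h => Journey.shift h _ G.ζ_pos fun w w' t ht hc =>
      (hp.crossable_add_iff m (by linarith)).2 hc

/-- Every node other than `x` can be reached from `x` by a journey within `[e, e + D]`. -/
def Covers (G : TVG) (x : ℕ) (e D : ℝ) : Prop :=
  ∀ v ∈ G.nodes, v ≠ x → ∃ k d a, e ≤ d ∧ a ≤ e + D ∧ G.HasJourney x v k d a

theorem PeriodicWith.covers_add_iff {p : ℝ} (hp : G.PeriodicWith p) (m : ℕ) {e D : ℝ}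
    (he : 0 ≤ e) : G.Covers x (e + m * p) D ↔ G.Covers x e D := by
  have hmp : 0 ≤ m * p := by have := hp.1; positivity
  constructor
  · intro h v hv hvx
    obtain ⟨k, d, a, h1, h2, h3⟩ := h v hv hvx
    refine ⟨k, d - m * p, a - m * p, by linarith, by linarith, ?_⟩
    rw [← hp.hasJourney_add_iff m (by linarith)]
    simpa using h3
  · intro h v hv hvx
    obtain ⟨k, d, a, h1, h2, h3⟩ := h v hv hvx
    exact ⟨k, d + m * p, a + m * p, by linarith, by linarith,
      (hp.hasJourney_add_iff m (by linarith)).2 h3⟩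

theorem exists_covers (hconn : G.footprint.Connected) (hG : G.Recurring) (hx : x ∈ G.nodes)
    (ht₀ : 0 ≤ t₀) : ∃ D, 0 ≤ D ∧ G.Covers x t₀ D := by
  have : ∀ v, ∃ b, v ∈ G.nodes → v ≠ x → ∃ k d, t₀ ≤ d ∧ G.HasJourney x v k d b := by
    intro v
    by_cases hv : v ∈ G.nodes ∧ v ≠ x
    · obtain ⟨k, d, a, h1, h2⟩ := exists_journey hconn hG hx hv.1 hv.2 ht₀
      exact ⟨a, fun _ _ => ⟨k, d, h1, h2⟩⟩
    · exact ⟨0, fun h1 h2 => absurd ⟨h1, h2⟩ hv⟩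
  choose f hf using this
  obtain ⟨B, hB⟩ := (G.nodes.finite_toSet.image f).bddAbove
  refine ⟨max 0 (B - t₀), le_max_left _ _, fun v hv hvx => ?_⟩
  obtain ⟨k, d, h1, h2⟩ := hf v hv hvx
  refine ⟨k, d, f v, h1, ?_, h2⟩
  have h3 : f v ≤ B := hB ⟨v, hv, rfl⟩
  linarith [le_max_right 0 (B - t₀)]

/-- In a periodic TVG, the minimal duration of a broadcast is attained. -/
theorem PeriodicWith.exists_isLeast_broadcastDurations {p : ℝ} (hp : G.PeriodicWith p)
    (hconn : G.footprint.Connected) (hx : x ∈ G.nodes) (ht₀ : 0 ≤ t₀)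
    (hne : ∃ v ∈ G.nodes, v ≠ x) : ∃ D, IsLeast (G.broadcastDurations x t₀) D := by
  have hζ := G.ζ_pos
  have hppos := hp.1
  obtain ⟨D₁, hD₁, hcov⟩ := exists_covers hconn hp.crossBound.recurring hx ht₀
  -- Up to periods, it suffices to consider windows starting in `[t₀, t₀ + p]`; those longer than
  -- `D₁` cannot be better. The remaining ones end by `B`, and their journeys have at most `N` hops,
  -- each lasting `ζ`.
  set B := t₀ + p + D₁
  obtain ⟨N, hN⟩ := exists_nat_gt ((B - t₀) / G.ζ)
  rw [div_lt_iff₀ hζ] at hN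
  let S : Set (ℝ × ℝ) := (⋂ v ∈ {v | v ∈ G.nodes ∧ v ≠ x},
    ⋃ k ∈ Finset.range N, G.journeyWindows x t₀ B k v) ∩ {q | q.1 ≤ t₀ + p}
  have hS : ∀ e D, t₀ ≤ e → e ≤ t₀ + p → D ≤ D₁ → G.Covers x e D → (e, e + D) ∈ S := by
    intro e D h1 h2 h3 h
    refine ⟨mem_iInter₂.2 fun v hv => ?_, h2⟩
    obtain ⟨k, d, a, h4, h5, h6⟩ := h v hv.1 hv.2
    have hk := h6.one_le
    have hka := h6.add_le
    obtain ⟨j, rfl⟩ := Nat.exists_eq_add_of_le' hk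
    have hjN : j < N := by
      by_contra! hc
      have : (N : ℝ) ≤ (j + 1 : ℕ) := by exact_mod_cast hc.trans (Nat.le_succ j)
      nlinarith
    exact mem_iUnion₂.2 ⟨j, Finset.mem_range.2 hjN, h1, by simp only; linarith, d, a, h4, h5, h6⟩
  have hcl : IsClosed S := by
    refine IsClosed.inter (isClosed_biInter fun v _ => ?_) (isClosed_le (by fun_prop) (by fun_prop))
    exact (Finset.range N).finite_toSet.isClosed_biUnion fun k _ =>
      (isCompact_journeyWindows G x t₀ B k v).isClosed
  have hmem : ∀ q ∈ S, t₀ ≤ q.1 ∧ q.2 ≤ B ∧ q.1 ≤ q.2 ∧ G.Covers x q.1 (q.2 - q.1) := by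
    rintro q ⟨hq, -⟩
    have hq' : ∀ v ∈ G.nodes, v ≠ x → ∃ k, q ∈ G.journeyWindows x t₀ B k v := by
      intro v hv hvx
      obtain ⟨k, -, hk⟩ := mem_iUnion₂.1 (mem_iInter₂.1 hq v ⟨hv, hvx⟩)
      exact ⟨k, hk⟩
    -- A node other than `x` is what bounds the windows: a journey to it forces `q.1 ≤ q.2`.
    obtain ⟨v, hv, hvx⟩ := hne
    obtain ⟨k, h1, h2, d, a, h3, h4, h5⟩ := hq' v hv hvx
    have := h5.lt hζ
    refine ⟨h1, h2, by linarith, fun w hw hwx => ?_⟩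
    obtain ⟨k, -, -, d, a, h3, h4, h5⟩ := hq' w hw hwx
    exact ⟨k + 1, d, a, h3, by linarith, h5⟩
  have hcomp : IsCompact S := by
    refine ((isCompact_Icc (a := t₀) (b := B)).prod (isCompact_Icc (a := t₀) (b := B))).of_isClosed_subset
      hcl fun q hq => ?_
    obtain ⟨h1, h2, h3, -⟩ := hmem q hq
    exact ⟨⟨h1, h3.trans h2⟩, ⟨h1.trans h3, h2⟩⟩
  obtain ⟨q, hq, hmin⟩ := hcomp.exists_isMinOn (f := fun q : ℝ × ℝ => q.2 - q.1)
    ⟨_, hS t₀ D₁ le_rfl (by linarith) le_rfl hcov⟩ (by fun_prop)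
  have hmin' : ∀ e D, t₀ ≤ e → e ≤ t₀ + p → D ≤ D₁ → G.Covers x e D → q.2 - q.1 ≤ D := by
    intro e D h1 h2 h3 h4
    have : q.2 - q.1 ≤ e + D - e := hmin (hS e D h1 h2 h3 h4)
    linarith
  obtain ⟨h1, -, -, h2⟩ := hmem q hq
  refine ⟨q.2 - q.1, ⟨q.1, h1, h2⟩, ?_⟩
  rintro D ⟨e, he, h⟩
  change G.Covers x e D at h
  rcases le_total D D₁ with hD | hD
  · obtain ⟨m, e', h3, h4, rfl⟩ := TVG.exists_shift hppos he
    rw [hp.covers_add_iff m (ht₀.trans h3)] at h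
    exact hmin' e' D h3 h4.le hD h
  · exact (hmin' t₀ D₁ le_rfl (by linarith) le_rfl hcov).trans hD

/-- A fastest broadcast leaves the emitter at the beginning of its window. -/
theorem exists_crossable_of_isLeast {D e : ℝ} (hD : IsLeast (G.broadcastDurations x t₀) D)
    (he : t₀ ≤ e) (hcov : G.Covers x e D) (hne : ∃ v ∈ G.nodes, v ≠ x) :
    ∃ w, G.Crossable x w e := by
  have : ∀ v, ∃ d, v ∈ G.nodes → v ≠ x → ∃ k a, e ≤ d ∧ a ≤ e + D ∧ G.HasJourney x v k d a := by
    intro v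
    by_cases hv : v ∈ G.nodes ∧ v ≠ x
    · obtain ⟨k, d, a, h⟩ := hcov v hv.1 hv.2
      exact ⟨d, fun _ _ => ⟨k, a, h⟩⟩
    · exact ⟨0, fun h1 h2 => absurd ⟨h1, h2⟩ hv⟩
  choose f hf using this
  obtain ⟨v, ⟨hv, hvx⟩, hmin⟩ := Set.exists_min_image {v | v ∈ G.nodes ∧ v ≠ x} f
    (G.nodes.finite_toSet.subset fun v hv => hv.1) hne
  obtain ⟨k, a, h1, -, h2⟩ := hf v hv hvx
  obtain ⟨w, hw⟩ := Journey.exists_first h2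
  -- Starting the window at the earliest departure `f v` would shorten it by `f v - e`, which
  -- minimality excludes unless `e = f v`.
  have : D ≤ D - (f v - e) := by
    refine hD.2 ⟨f v, he.trans h1, fun u hu hux => ?_⟩
    obtain ⟨k, a, -, h4, h5⟩ := hf u hu hux
    exact ⟨k, f u, a, hmin u ⟨hu, hux⟩, by linarith, h5⟩
  obtain rfl : e = f v := by linarith
  exact ⟨w, hw⟩

end TVG

/-! ### Fastest broadcast -/

/-- The dates `e ≥ t₀` at which a broadcast of minimal duration can start, where `P` gives the
presence of the edges from date `t₀` on and `N` is the set of nodes. -/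
def optimalStarts (ζ t₀ : ℝ) (x : ℕ) (N : Set ℕ) (P : ℕ → ℕ → Set ℝ) : Set ℝ :=
  {e | t₀ ≤ e ∧ ∃ D, IsLeast {D | ∃ e ≥ t₀, ∀ v ∈ N, v ≠ x → ∃ k d a, e ≤ d ∧ a ≤ e + D ∧
      Journey (fun u w t => Icc t (t + ζ) ⊆ P u w) ζ x v k d a} D ∧
    ∀ v ∈ N, v ≠ x → ∃ k d a, e ≤ d ∧ a ≤ e + D ∧
      Journey (fun u w t => Icc t (t + ζ) ⊆ P u w) ζ x v k d a}

theorem journey_inter_Ici_iff {G : TVG} {t₀ : ℝ} {x v k : ℕ} {d a : ℝ} (hd : t₀ ≤ d) :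
    Journey (fun u w t => Icc t (t + G.ζ) ⊆ G.present u w ∩ Ici t₀) G.ζ x v k d a ↔
      G.HasJourney x v k d a :=
  ⟨fun h => Journey.mono G.ζ_pos h fun _ _ _ _ _ h => h.trans inter_subset_left,
    fun h => Journey.mono G.ζ_pos h fun _ _ _ ht _ h =>
      subset_inter h fun _ hy => (hd.trans ht).trans hy.1⟩

theorem mem_optimalStarts_iff {G : TVG} {t₀ : ℝ} {x : ℕ} {e : ℝ} :
    e ∈ optimalStarts G.ζ t₀ x G.nodes (fun u w => G.present u w ∩ Ici t₀) ↔
      t₀ ≤ e ∧ ∃ D, IsLeast (G.broadcastDurations x t₀) D ∧ G.Covers x e D := by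
  have key : ∀ {e D : ℝ}, t₀ ≤ e → ((∀ v ∈ (G.nodes : Set ℕ), v ≠ x → ∃ k d a, e ≤ d ∧
      a ≤ e + D ∧ Journey (fun u w t => Icc t (t + G.ζ) ⊆ G.present u w ∩ Ici t₀) G.ζ x v k d a) ↔
      G.Covers x e D) := by
    intro e D he
    refine forall₃_congr fun v _ _ => exists_congr fun k => exists_congr fun d =>
      exists_congr fun a => and_congr_right fun hd => and_congr_right fun _ =>
      journey_inter_Ici_iff (he.trans hd)
  unfold optimalStarts
  refine and_congr_right fun he => exists_congr fun D => and_congr ?_ (key he)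
  have : {D | ∃ e ≥ t₀, ∀ v ∈ (G.nodes : Set ℕ), v ≠ x → ∃ k d a, e ≤ d ∧ a ≤ e + D ∧
      Journey (fun u w t => Icc t (t + G.ζ) ⊆ G.present u w ∩ Ici t₀) G.ζ x v k d a} =
      G.broadcastDurations x t₀ := by
    ext D
    exact exists_congr fun e => and_congr_right fun he => key he
  rw [this]

/-- The presence of edges that can be deduced from the known records, for the period `p`. -/
def View.knownPresence (p : ℝ) (V : View (Set Rec)) (u v : ℕ) : Set ℝ :=
  {t | ∃ ρ ∈ V.records, ρ.id = u ∧ ∃ r ∈ ρ.present v, ∃ m : ℕ, t = r + m * p}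

/-- The optimal date computed from the known records. -/
noncomputable def View.bestStart (ζ p : ℝ) (V : View (Set Rec)) : ℝ :=
  Classical.epsilon fun e =>
    e ∈ optimalStarts ζ V.start V.id (Rec.id '' V.records) (V.knownPresence p)

/-- The emitter is active from an optimal date on, when it knows the whole TVG; the other nodes are
active when they have received the information. -/
def fastestActive (ζ p : ℝ) (V : View (Set Rec)) : Prop :=
  (V.isEmitter ∧ ∃ e, V.start ≤ e ∧ e ≤ V.now ∧ closedNodes p V.start (V.truncate e).records ∧
    ∃ m : ℕ, e = (V.truncate e).bestStart ζ p + m * p) ∨ (¬ V.isEmitter ∧ V.holds)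

theorem fastestActive_holds {ζ p : ℝ} (V : View (Set Rec)) (h : fastestActive ζ p V) : V.holds :=
  h.elim (fun h => .inl h.1) (fun h => h.2)

/-! ### The starting date computed by the emitter -/

section Fastest

variable {G : TVG} {x : ℕ} {t₀ p τ : ℝ} {act : View (Set Rec) → Prop}
  {cmp : ℝ → Set Rec → Prop} {s : Sends (Set Rec)}

theorem gossip_detects (hτ : 0 < τ) (ht₀ : 0 ≤ t₀) (hconn : G.footprint.Connected)
    (hG : G.Recurring) (hs : (gossip τ act cmp).IsExecution G x t₀ s) {u : ℕ}
    (hu : u ∈ G.nodes) {cmp' : ℝ → Set Rec → Prop} (hcmp' : Detects G cmp') :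
    ∃ T, ∀ t ≥ T, t₀ ≤ t → cmp' t₀ (viewAt G x t₀ s u t).records := by
  obtain ⟨D, hD⟩ := hcmp'.live t₀ ht₀
  obtain ⟨T, hT⟩ := gossip_spreads_all hτ ht₀ hconn hG hs hu (le_max_left t₀ D)
  exact ⟨T, fun t ht h0 => hD _ (truthful_records hs h0 hu) fun v hv =>
    ⟨_, hT t ht v hv, rfl, le_max_right t₀ D⟩⟩

/-- Complete records determine the nodes and the presence of the edges. -/
theorem bestStart_eq (hconn : G.footprint.Connected) (hp : G.PeriodicWith p) (ht₀ : 0 ≤ t₀)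
    (hs : (gossip τ act cmp).IsExecution G x t₀ s) {t : ℝ} (ht : t₀ ≤ t) {u : ℕ}
    (hu : u ∈ G.nodes) (h : closedNodes p t₀ (viewAt G x t₀ s u t).records) :
    (viewAt G x t₀ s u t).bestStart G.ζ p = Classical.epsilon fun e =>
      e ∈ optimalStarts G.ζ t₀ u G.nodes (fun v w => G.present v w ∩ Ici t₀) := by
  have htr := truthful_records hs ht hu
  have hcov := closedNodes_sound hconn hp.crossBound ht₀ htr h
  have h1 : Rec.id '' (viewAt G x t₀ s u t).records = G.nodes := by
    ext v
    constructor
    · rintro ⟨ρ, hρ, rfl⟩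
      exact (htr ρ hρ).1
    · intro hv
      obtain ⟨ρ, hρ, h, -⟩ := hcov v hv
      exact ⟨ρ, hρ, h⟩
  -- A record made at least `p` after the start shows a whole period, whose forward translates give
  -- the presence from `t₀` on.
  have h2 : (viewAt G x t₀ s u t).knownPresence p = fun v w => G.present v w ∩ Ici t₀ := by
    funext v w
    ext r
    constructor
    · rintro ⟨ρ, hρ, rfl, q, hq, m, rfl⟩
      rw [(htr ρ hρ).2.2] at hq
      have h0 : 0 ≤ m * p := by have := hp.1; positivity
      exact ⟨(hp.mem_add_iff m (ht₀.trans hq.2.1)).2 hq.1, by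
        have := hq.2.1
        simp only [mem_Ici]
        linarith⟩
    · rintro ⟨hr, hr0⟩
      obtain ⟨ρ, hρ, rfl, hnow⟩ := hcov v (TVG.IsEdge.left_mem ⟨r, hr⟩)
      obtain ⟨m, q, h3, h4, rfl⟩ := TVG.exists_shift hp.1 (show t₀ ≤ r from hr0)
      refine ⟨ρ, hρ, rfl, q, ?_, m, rfl⟩
      rw [(htr ρ hρ).2.2]
      exact ⟨(hp.mem_add_iff m (ht₀.trans h3)).1 hr, h3, by linarith⟩
  unfold View.bestStart
  rw [h1, h2]
  rfl

/-- When there are several nodes, the emitter is active from some optimal date on. -/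
theorem exists_fastestActive_iff (hτ : 0 < τ) (hconn : G.footprint.Connected)
    (hp : G.PeriodicWith p) (ht₀ : 0 ≤ t₀) (hx : x ∈ G.nodes) (hne : ∃ v ∈ G.nodes, v ≠ x)
    (hs : (gossip τ act cmp).IsExecution G x t₀ s) :
    ∃ e D, t₀ ≤ e ∧ IsLeast (G.broadcastDurations x t₀) D ∧ G.Covers x e D ∧
      (∃ w, G.Crossable x w e) ∧
      ∀ t, t₀ ≤ t → (fastestActive G.ζ p (viewAt G x t₀ s x t) ↔ e ≤ t) := by
  classical
  have hppos := hp.1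
  -- Complete records always yield this same predicate, so the choice `e₀` does not depend on when
  -- the emitter computes it.
  set e₀ := Classical.epsilon fun e =>
      e ∈ optimalStarts G.ζ t₀ x G.nodes (fun v w => G.present v w ∩ Ici t₀) with he₀
  obtain ⟨he₀t, D, hD, hcov⟩ : t₀ ≤ e₀ ∧ ∃ D, IsLeast (G.broadcastDurations x t₀) D ∧
      G.Covers x e₀ D := by
    rw [← mem_optimalStarts_iff]
    obtain ⟨D, hD⟩ := hp.exists_isLeast_broadcastDurations hconn hx ht₀ hne
    obtain ⟨e, he, hcov⟩ := hD.1
    exact Classical.epsilon_spec (p := fun e =>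
      e ∈ optimalStarts G.ζ t₀ x G.nodes (fun v w => G.present v w ∩ Ici t₀))
      ⟨e, mem_optimalStarts_iff.2 ⟨he, D, hD, hcov⟩⟩
  obtain ⟨w, hw⟩ := TVG.exists_crossable_of_isLeast hD he₀t hcov hne
  have hle : ∀ m : ℕ, t₀ ≤ e₀ + m * p := fun m => by
    have : 0 ≤ m * p := by positivity
    linarith
  -- At `e₀` the emitter may not know enough yet. The start is the first translate of `e₀` by
  -- periods at which its knowledge is complete; it is still optimal.
  have hex : ∃ m : ℕ, closedNodes p t₀ (viewAt G x t₀ s x (e₀ + m * p)).records := by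
    obtain ⟨T, hT⟩ := gossip_detects hτ ht₀ hconn hp.crossBound.recurring hs hx
      (detects_closedNodes hconn hp.crossBound)
    obtain ⟨m, hm⟩ := exists_nat_gt ((T - e₀) / p)
    rw [div_lt_iff₀ hppos] at hm
    exact ⟨m, hT _ (by linarith) (hle m)⟩
  have he0 : 0 ≤ e₀ := ht₀.trans he₀t
  refine ⟨e₀ + Nat.find hex * p, D, hle _, hD, (hp.covers_add_iff _ he0).2 hcov,
    ⟨w, (hp.crossable_add_iff _ he0).2 hw⟩, fun t ht => ⟨?_, fun h => ?_⟩⟩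
  · rintro (⟨-, e, h1, h2, h3, m, h4⟩ | ⟨h, -⟩)
    · have h2' : e ≤ t := h2
      have h1' : t₀ ≤ e := h1
      rw [viewAt_truncate h2'] at h3 h4
      rw [bestStart_eq hconn hp ht₀ hs h1' hx h3, ← he₀] at h4
      have h5 : Nat.find hex ≤ m := Nat.find_min' hex (by rw [← h4]; exact h3)
      have h6 : (Nat.find hex : ℝ) ≤ m := by exact_mod_cast h5
      have := mul_le_mul_of_nonneg_right h6 hppos.le
      linarith
    · exact absurd rfl h
  · refine .inl ⟨rfl, _, hle _, h, ?_, Nat.find hex, ?_⟩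
    · rw [viewAt_truncate h]
      exact Nat.find_spec hex
    · rw [viewAt_truncate h, bestStart_eq hconn hp ht₀ hs (hle _) hx (Nat.find_spec hex)]

end Fastest

/-- With a known period, waiting for an optimal date solves fastest broadcast. -/
theorem gossip_solves_fastest {G : TVG} {p : ℝ} (hconn : G.footprint.Connected)
    (hp : G.PeriodicWith p) :
    (gossip 1 (fastestActive G.ζ p) (closedNodes p)).Solves TDBfastest G := by
  refine gossip_solves one_pos fun x hx t₀ ht₀ s hs => ?_
  have hG := hp.crossBound.recurring
  have hdet := detects_closedNodes hconn hp.crossBound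
  by_cases hne : ∃ v ∈ G.nodes, v ≠ x
  swap
  · refine ⟨gossip_TDB one_pos fastestActive_holds ht₀ hx hconn hG hdet hs
      fun v hv hvx => absurd ⟨v, hv, hvx⟩ hne, fun h => absurd h hne⟩
  obtain ⟨e, D, he, hD, hcov, ⟨w, hw⟩, hact⟩ :=
    exists_fastestActive_iff one_pos hconn hp ht₀ hx hne hs
  set T := (gossip 1 (fastestActive G.ζ p) (closedNodes p)).trace G x t₀ s
  have hother : ∀ u ≠ x, ∀ t, t₀ ≤ t →
      (fastestActive G.ζ p (viewAt G x t₀ s u t) ↔ (viewAt G x t₀ s u t).holds) :=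
    fun u hu t _ => ⟨fastestActive_holds _, fun h => .inr ⟨hu, h⟩⟩
  have hrec : ∀ v ∈ G.nodes, v ≠ x → ∃ r, IsLeast (receptions G T x v) r ∧ r ≤ e + D := by
    intro v hv hvx
    obtain ⟨k, d, a, h1, h2, hj⟩ := hcov v hv hvx
    obtain ⟨b, hb, hba⟩ :=
      flooding_le_journey one_pos fastestActive_holds hs he hact hother h1 hj
    obtain ⟨r, hr⟩ := gossip_exists_isLeast one_pos hs ⟨b, hb⟩
    exact ⟨r, hr, (hr.2 hb).trans (hba.trans h2)⟩
  have hemit : ∀ {v t}, T.emits x v t → e ≤ t := fun h => by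
    obtain ⟨h1, -, -, h2⟩ := (gossip_emits_iff hs).1 h
    exact (hact _ h1).1 h2
  refine ⟨gossip_TDB one_pos fastestActive_holds ht₀ hx hconn hG hdet hs
    fun v hv hvx => ?_, fun _ => ?_⟩
  · obtain ⟨r, hr, -⟩ := hrec v hv hvx
    exact ⟨r, hr.1⟩
  have hrec' : ∀ v, ∃ r, v ∈ G.nodes → v ≠ x → IsLeast (receptions G T x v) r ∧ r ≤ e + D := by
    intro v
    by_cases hv : v ∈ G.nodes ∧ v ≠ x
    · obtain ⟨r, hr⟩ := hrec v hv.1 hv.2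
      exact ⟨r, fun _ _ => hr⟩
    · exact ⟨0, fun h1 h2 => absurd ⟨h1, h2⟩ hv⟩
  choose f hf using hrec'
  obtain ⟨v, ⟨hv, hvx⟩, hmax⟩ := Set.exists_max_image {v | v ∈ G.nodes ∧ v ≠ x} f
    (G.nodes.finite_toSet.subset fun v hv => hv.1) hne
  -- The information journeys depart from `e` on and arrive by `f v`, so `[e, f v]` is itself a
  -- covering window. The reverse inequality comes from flooding.
  have hDle : D ≤ f v - e := by
    refine hD.2 ⟨e, he, fun u hu hux => ?_⟩
    obtain ⟨k, d, hj⟩ := (hf u hu hux).1.1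
    obtain ⟨w', h1, -⟩ := Journey.exists_first hj
    have := hmax u ⟨hu, hux⟩
    exact ⟨k, d, f u, hemit h1, by linarith, InfoJourney.hasJourney hj⟩
  have hlD : f v - e = D := by linarith [(hf v hv hvx).2]
  refine ⟨e, f v, ⟨⟨w, ?_⟩, ?_⟩, ⟨⟨v, hv, hvx, (hf v hv hvx).1⟩, ?_⟩, by rwa [hlD]⟩
  -- The first emission is at `e` exactly: the edge to `w` is usable at `e`, and becoming active
  -- triggers a message.
  · exact (gossip_emits_iff hs).2 ⟨he, hw.mem, fires_of_act he hact, (hact e he).2 le_rfl⟩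
  · rintro t ⟨v, h⟩
    exact hemit h
  · rintro r ⟨u, hu, hux, hr⟩
    rw [hr.unique (hf u hu hux).1]
    exact hmax u ⟨hu, hux⟩

/-! ### Slotted TVGs -/

/-- The slots of the edge `uv`, prescribed by `C` for `u < v < n`. -/
def slots (n : ℕ) (C : ℕ → ℕ → Set ℕ) (u v : ℕ) : Set ℕ :=
  {k | (u < v ∧ v < n ∧ k ∈ C u v) ∨ (v < u ∧ u < n ∧ k ∈ C v u)}

theorem slots_symm {n : ℕ} {C : ℕ → ℕ → Set ℕ} (u v : ℕ) : slots n C u v = slots n C v u := by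
  ext k
  exact or_comm

theorem slots_eq {n : ℕ} {C : ℕ → ℕ → Set ℕ} {u v : ℕ} (h : u < v) (hv : v < n) :
    slots n C u v = C u v := by
  ext k
  exact ⟨fun hk => hk.elim (fun hk => hk.2.2) (fun hk => absurd hk.1 (by omega)),
    fun hk => .inl ⟨h, hv, hk⟩⟩

theorem exists_slots_eq {n : ℕ} {C : ℕ → ℕ → Set ℕ} {u v : ℕ} (h : (slots n C u v).Nonempty) :
    ∃ a b, a < b ∧ b < n ∧ slots n C u v = C a b := by
  obtain ⟨k, ⟨h1, h2, -⟩ | ⟨h1, h2, -⟩⟩ := h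
  · exact ⟨u, v, h1, h2, slots_eq h1 h2⟩
  · exact ⟨v, u, h1, h2, by rw [slots_symm, slots_eq h1 h2]⟩

/-- The edge `uv` is present during `[2 k ζ, 2 k ζ + ζ]` for each of its slots `k`. -/
def slotTVG (n : ℕ) (hn : 0 < n) (ζ : ℝ) (hζ : 0 < ζ) (C : ℕ → ℕ → Set ℕ) : TVG where
  nodes := Finset.range n
  nodes_nonempty := ⟨0, Finset.mem_range.2 hn⟩
  ζ := ζ
  ζ_pos := hζ
  present u v := {t | ∃ k ∈ slots n C u v, t ∈ Icc (2 * k * ζ) (2 * k * ζ + ζ)}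
  present_symm u v := by rw [slots_symm]
  present_irrefl u := by
    ext t
    refine ⟨?_, fun h => h.elim⟩
    rintro ⟨k, h | h, -⟩ <;> exact absurd h.1 (lt_irrefl u)
  present_nodes u v := by
    rintro ⟨t, k, h | h, -⟩ <;> rw [Finset.mem_range] <;> omega
  present_nonneg u v := by
    rintro t ⟨k, -, h, -⟩
    exact le_trans (by positivity) h
  present_intervals u v := by
    refine ⟨(fun k : ℕ => Icc (2 * k * ζ) (2 * k * ζ + ζ)) '' slots n C u v, ?_, ?_, ?_⟩
    · have key : ∀ i j : ℕ, ∀ t, t ∈ Icc (2 * i * ζ) (2 * i * ζ + ζ) →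
          t ∈ Icc (2 * j * ζ) (2 * j * ζ + ζ) → i ≤ j := by
        intro i j t hi hj
        by_contra! h
        have : (j : ℝ) + 1 ≤ i := by exact_mod_cast h
        have h1 := hi.1
        have h2 := hj.2
        nlinarith
      rintro _ ⟨i, -, rfl⟩ _ ⟨j, -, rfl⟩ hne
      refine Set.disjoint_left.2 fun t hi hj => hne ?_
      rw [le_antisymm (key i j t hi hj) (key j i t hj hi)]
    · rintro _ ⟨k, -, rfl⟩
      exact .inl ⟨_, _, le_rfl, rfl⟩
    · ext t
      simp only [sUnion_image, mem_iUnion, exists_prop]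
      rfl

section Slots

variable {n : ℕ} {hn : 0 < n} {ζ : ℝ} {hζ : 0 < ζ} {C : ℕ → ℕ → Set ℕ}

theorem slotTVG_crossable_iff {u v : ℕ} {t : ℝ} : (slotTVG n hn ζ hζ C).Crossable u v t ↔
    ∃ k ∈ slots n C u v, t = 2 * k * ζ := by
  constructor
  · intro h
    obtain ⟨k, hk, h1, h2⟩ := h.mem
    refine ⟨k, hk, le_antisymm ?_ h1⟩
    by_contra! hlt
    -- A crossing begun after the start of slot `k` would need the edge at this date, which lies in
    -- the gap between slots `k` and `k + 1`.
    obtain ⟨j, -, h3, h4⟩ := h (show min (t + ζ) (2 * k * ζ + 3 / 2 * ζ) ∈ Icc t (t + ζ) from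
      ⟨le_min (by linarith) (by linarith), min_le_left _ _⟩)
    have h5 : 2 * k * ζ + ζ < min (t + ζ) (2 * k * ζ + 3 / 2 * ζ) :=
      lt_min (by linarith) (by linarith)
    have h6 := min_le_right (t + ζ) (2 * k * ζ + 3 / 2 * ζ)
    rcases le_or_gt j k with hjk | hjk
    · have : (j : ℝ) ≤ k := by exact_mod_cast hjk
      nlinarith
    · have : (k : ℝ) + 1 ≤ j := by exact_mod_cast hjk
      nlinarith
  · rintro ⟨k, hk, rfl⟩ y hy
    exact ⟨k, hk, hy⟩

theorem slotTVG_appears_iff {u v : ℕ} {t : ℝ} : (slotTVG n hn ζ hζ C).Appears u v t ↔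
    ∃ k ∈ slots n C u v, t = 2 * k * ζ := by
  constructor
  · exact fun h => slotTVG_crossable_iff.1 h.crossable
  · rintro ⟨k, hk, rfl⟩
    refine ⟨⟨k, hk, le_rfl, by linarith⟩, ζ, hζ, ?_⟩
    rintro s h1 h2 ⟨j, -, h3, h4⟩
    rcases lt_or_ge j k with hjk | hjk
    · have : (j : ℝ) + 1 ≤ k := by exact_mod_cast hjk
      nlinarith
    · have : (k : ℝ) ≤ j := by exact_mod_cast hjk
      nlinarith

theorem slotTVG_isEdge {u v : ℕ} (h : (slotTVG n hn ζ hζ C).IsEdge u v) :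
    ∃ a b, a < b ∧ b < n ∧ slots n C u v = C a b ∧ (C a b).Nonempty := by
  obtain ⟨t, k, hk, -⟩ := h
  obtain ⟨a, b, h1, h2, h3⟩ := exists_slots_eq ⟨k, hk⟩
  exact ⟨a, b, h1, h2, h3, k, h3 ▸ hk⟩

theorem slotTVG_recurrenceBound {g : ℕ} (hg : 0 < g)
    (h : ∀ a b, a < b → b < n → (C a b).Nonempty → ∀ m, ∃ k ∈ C a b, m ≤ k ∧ k < m + g) :
    (slotTVG n hn ζ hζ C).RecurrenceBound (2 * g * ζ) := by
  refine ⟨by positivity, fun u v he => ?_⟩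
  obtain ⟨a, b, h1, h2, h3, h4⟩ := slotTVG_isEdge he
  have h' := h a b h1 h2 h4
  rw [← h3] at h'
  constructor
  · obtain ⟨k, hk, -, hk'⟩ := h' 0
    refine ⟨2 * k * ζ, ?_, slotTVG_appears_iff.2 ⟨k, hk, rfl⟩⟩
    have : (k : ℝ) ≤ g := by exact_mod_cast (by omega : k ≤ g)
    gcongr
  · intro s s' hs hs' hlt hno
    obtain ⟨i, -, rfl⟩ := slotTVG_appears_iff.1 hs
    obtain ⟨j, -, rfl⟩ := slotTVG_appears_iff.1 hs'
    obtain ⟨k, hk, hk1, hk2⟩ := h' (i + 1)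
    have hjk : j ≤ k := by
      by_contra! hc
      refine hno (2 * k * ζ) ?_ ?_ (slotTVG_appears_iff.2 ⟨k, hk, rfl⟩)
      · have : (i : ℝ) < k := by exact_mod_cast hk1
        gcongr
      · have : (k : ℝ) < j := by exact_mod_cast hc
        gcongr
    have : (j : ℝ) ≤ i + g := by exact_mod_cast (by omega : j ≤ i + g)
    nlinarith

theorem slotTVG_periodicWith {q : ℕ} (hq : 0 < q)
    (h : ∀ a b k, a < b → b < n → (k ∈ C a b ↔ k + q ∈ C a b)) :
    (slotTVG n hn ζ hζ C).PeriodicWith (2 * q * ζ) := by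
  refine ⟨by positivity, fun u v t ht => ?_⟩
  have h' : ∀ k, k ∈ slots n C u v ↔ k + q ∈ slots n C u v := fun k =>
    or_congr (and_congr_right fun h1 => and_congr_right fun h2 => h u v k h1 h2)
      (and_congr_right fun h1 => and_congr_right fun h2 => h v u k h1 h2)
  constructor
  · rintro ⟨k, hk, h1, h2⟩
    refine ⟨k + q, (h' k).1 hk, ?_, ?_⟩ <;> push_cast <;> linarith
  · rintro ⟨j, hj, h1, h2⟩
    have hjq : q ≤ j := by
      by_contra! hc
      have : (j : ℝ) + 1 ≤ q := by exact_mod_cast hc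
      nlinarith
    obtain ⟨k, rfl⟩ := Nat.exists_eq_add_of_le' hjq
    push_cast at h1 h2
    exact ⟨k, (h' k).2 hj, by linarith, by linarith⟩

theorem slotTVG_connected (h : ∀ v, 0 < v → v < n → (C 0 v).Nonempty) :
    (slotTVG n hn ζ hζ C).footprint.Connected := by
  rw [SimpleGraph.connected_iff_exists_forall_reachable]
  refine ⟨⟨0, Finset.mem_range.2 hn⟩, ?_⟩
  rintro ⟨v, hv⟩
  have hv' : v < n := Finset.mem_range.1 hv
  rcases Nat.eq_zero_or_pos v with rfl | hpos
  · exact SimpleGraph.Reachable.refl _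
  · obtain ⟨k, hk⟩ := h v hpos hv'
    refine SimpleGraph.Adj.reachable ?_
    refine (⟨2 * k * ζ, k, ?_, le_rfl, by linarith⟩ : (slotTVG n hn ζ hζ C).IsEdge 0 v)
    rw [slots_eq hpos hv']
    exact hk

theorem slotTVG_present_congr {C' : ℕ → ℕ → Set ℕ} {m : ℕ}
    (h : ∀ a b, ∀ k < m, k ∈ C a b ↔ k ∈ C' a b) {T : ℝ} (hT : T < 2 * m * ζ) (u v : ℕ) :
    ∀ r ≤ T, r ∈ (slotTVG n hn ζ hζ C).present u v ↔ r ∈ (slotTVG n hn ζ hζ C').present u v := by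
  intro r hr
  refine exists_congr fun k => and_congr_left fun hk => ?_
  have hkm : k < m := by
    by_contra! hc
    have : (m : ℝ) ≤ k := by exact_mod_cast hc
    have := hk.1
    nlinarith
  exact or_congr (and_congr_right fun _ => and_congr_right fun _ => h u v k hkm)
    (and_congr_right fun _ => and_congr_right fun _ => h v u k hkm)

end Slots

/-! ### Executions in TVGs that agree for a long time -/

section Agree

variable {A : Protocol} {G G' : TVG} {x : ℕ} {t₀ T : ℝ} {s s' : Sends A.Body}

theorem emits_congr (hζ : G'.ζ = G.ζ)
    (hG : ∀ u v, ∀ r ≤ T, r ∈ G.present u v ↔ r ∈ G'.present u v)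
    (hs : A.IsExecution G x t₀ s) (hs' : A.IsExecution G' x t₀ s') {u v : ℕ} {t : ℝ} (ht : t ≤ T) :
    (A.trace G x t₀ s).emits u v t ↔ (A.trace G' x t₀ s').emits u v t := by
  change (∃ m, s u v t = some m ∧ _) ↔ (∃ m, s' u v t = some m ∧ _)
  rw [hs.congr hζ hG hs' u v t ht]

theorem receptions_subset (hζ : G'.ζ = G.ζ)
    (hG : ∀ u v, ∀ r ≤ T, r ∈ G.present u v ↔ r ∈ G'.present u v)
    (hs : A.IsExecution G x t₀ s) (hs' : A.IsExecution G' x t₀ s') {v : ℕ} {a : ℝ} (ha : a ≤ T)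
    (h : a ∈ receptions G (A.trace G x t₀ s) x v) :
    a ∈ receptions G' (A.trace G' x t₀ s') x v := by
  obtain ⟨k, d, hj⟩ := h
  refine ⟨k, d, ?_⟩
  unfold InfoJourney
  rw [hζ]
  refine Journey.mono G.ζ_pos hj fun w w' t _ h2 ⟨h3, h4⟩ => ?_
  have hζpos := G.ζ_pos
  refine ⟨(emits_congr hζ hG hs hs' (by linarith)).1 h3, fun y hy => ?_⟩
  rw [hζ] at hy
  exact (hG w w' y (by linarith [hy.2])).1 (h4 hy)

theorem receptions_congr (hζ : G'.ζ = G.ζ)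
    (hG : ∀ u v, ∀ r ≤ T, r ∈ G.present u v ↔ r ∈ G'.present u v)
    (hs : A.IsExecution G x t₀ s) (hs' : A.IsExecution G' x t₀ s') {v : ℕ} {a : ℝ} (ha : a ≤ T) :
    a ∈ receptions G (A.trace G x t₀ s) x v ↔ a ∈ receptions G' (A.trace G' x t₀ s') x v :=
  ⟨receptions_subset hζ hG hs hs' ha,
    receptions_subset hζ.symm (fun u v r hr => (hG u v r hr).symm) hs' hs ha⟩

end Agree

theorem isLeast_of_agree {S S' : Set ℝ} {T r : ℝ} (h : ∀ a ≤ T, a ∈ S ↔ a ∈ S') (hrT : r ≤ T)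
    (hr : IsLeast S r) : IsLeast S' r := by
  refine ⟨(h r hrT).1 hr.1, fun b hb => ?_⟩
  rcases le_total b T with hbT | hbT
  · exact hr.2 ((h b hbT).2 hb)
  · exact hrT.trans hbT

/-! ### Impossibility of fastest broadcast -/

/-- A star with centre `0`, where node `1` is linked during the even slots and the other ones
during the odd slots and the extra slots in `E`. -/
def starSlots (E : Set ℕ) (u v : ℕ) : Set ℕ :=
  {k | u = 0 ∧ ((v = 1 ∧ Even k) ∨ (2 ≤ v ∧ (Odd k ∨ k ∈ E)))}

section Star

variable {n : ℕ} {hn : 0 < n} {ζ : ℝ} {hζ : 0 < ζ} {E : Set ℕ}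

theorem starSlots_connected : (slotTVG n hn ζ hζ (starSlots E)).footprint.Connected := by
  refine slotTVG_connected fun v hv _ => ?_
  rcases Nat.lt_or_ge v 2 with h | h
  · exact ⟨0, rfl, .inl ⟨by omega, Even.zero⟩⟩
  · exact ⟨1, rfl, .inr ⟨h, .inl odd_one⟩⟩

/-- Parity alone gives each edge one of any two consecutive slots. The bound does not depend on `E`,
so knowing it tells nothing about `E`. -/
theorem starSlots_recurrenceBound :
    (slotTVG n hn ζ hζ (starSlots E)).RecurrenceBound (4 * ζ) := by
  have : (slotTVG n hn ζ hζ (starSlots E)).RecurrenceBound (2 * (2 : ℕ) * ζ) := by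
    refine slotTVG_recurrenceBound two_pos ?_
    rintro a b h1 h2 ⟨k, rfl, h | h⟩ m
    · rcases Nat.even_or_odd m with hm | hm
      · exact ⟨m, ⟨rfl, .inl ⟨h.1, hm⟩⟩, le_rfl, by omega⟩
      · exact ⟨m + 1, ⟨rfl, .inl ⟨h.1, hm.add_one⟩⟩, by omega, by omega⟩
    · rcases Nat.even_or_odd m with hm | hm
      · exact ⟨m + 1, ⟨rfl, .inr ⟨h.1, .inl hm.add_one⟩⟩, by omega, by omega⟩
      · exact ⟨m, ⟨rfl, .inr ⟨h.1, .inl hm⟩⟩, le_rfl, by omega⟩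
  norm_num at this
  exact this

theorem starSlots_mem_classP {q : ℕ} (hq : 0 < q) (hE : ∀ k, k ∈ E ↔ k + 2 * q ∈ E) :
    slotTVG n hn ζ hζ (starSlots E) ∈ classP := by
  refine ⟨starSlots_connected, _, slotTVG_periodicWith (q := 2 * q) (by omega) ?_⟩
  intro a b k _ _
  have h1 : Even k ↔ Even (k + 2 * q) := by simp [Nat.even_add]
  have h2 : Odd k ↔ Odd (k + 2 * q) := by simp [Nat.odd_add]
  change (_ ∧ (_ ∧ _ ∨ _ ∧ (_ ∨ _))) ↔ (_ ∧ (_ ∧ _ ∨ _ ∧ (_ ∨ _)))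
  rw [← h1, ← h2, ← hE]

theorem starSlots_mem_classB {q : ℕ} (hq : 0 < q) (hE : ∀ k, k ∈ E ↔ k + 2 * q ∈ E) :
    slotTVG n hn ζ hζ (starSlots E) ∈ classB :=
  ⟨TVG.classP_subset_classR (starSlots_mem_classP hq hE), _, starSlots_recurrenceBound⟩

/-- Without extra slots, the broadcast from the centre takes more than one slot. -/
theorem lt_of_mem_broadcastDurations (hn3 : 3 ≤ n) {D t₀ : ℝ}
    (hD : D ∈ (slotTVG n hn ζ hζ (starSlots ∅)).broadcastDurations 0 t₀) : ζ < D := by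
  by_contra! hDζ
  obtain ⟨e, -, h⟩ := hD
  -- Within duration `ζ` there is only time for a single hop starting at `e`, so nodes `1` and `2`
  -- would share a slot, which their parities forbid.
  have key : ∀ v, 0 < v → v < n → ∃ k ∈ starSlots ∅ 0 v, e = 2 * k * ζ := by
    intro v hv hvn
    obtain ⟨k, d, a, h1, h2, h3⟩ := h v (Finset.mem_range.2 hvn) hv.ne'
    have hk := h3.one_le
    have hka : d + k * ζ ≤ a := h3.add_le
    have hk' : k = 1 := by
      by_contra hc
      have : (2 : ℝ) ≤ k := by exact_mod_cast (by omega : 2 ≤ k)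
      nlinarith
    subst hk'
    obtain ⟨hc, ha⟩ := Journey.crossing_of_one h3
    have ha' : a = d + ζ := ha
    obtain rfl : d = e := by linarith
    rw [← slots_eq (C := starSlots ∅) hv hvn]
    exact slotTVG_crossable_iff.1 hc
  obtain ⟨i, ⟨-, hi⟩, hei⟩ := key 1 (by omega) (by omega)
  obtain ⟨j, ⟨-, hj⟩, hej⟩ := key 2 (by omega) (by omega)
  have hij : i = j := by
    have : (i : ℝ) = j := mul_right_cancel₀ hζ.ne' (by linarith : (i : ℝ) * ζ = j * ζ)
    exact_mod_cast this
  subst hij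
  have h1 : Even i := hi.elim (fun h => h.2) (fun h => absurd h.1 (by omega))
  have h2 : Odd i := hj.elim (fun h => absurd h.1 (by omega)) (fun h => h.2.resolve_right id)
  exact Nat.not_even_iff_odd.2 h2 h1

/-- In an extra slot that is even, the broadcast from the centre takes one slot. -/
theorem mem_broadcastDurations_of_even {i : ℕ} (hi : Even i) (hiE : i ∈ E) :
    ζ ∈ (slotTVG n hn ζ hζ (starSlots E)).broadcastDurations 0 0 := by
  refine ⟨2 * i * ζ, by positivity, fun v hv hv0 => ⟨1, _, _, le_rfl, le_rfl, .single ?_⟩⟩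
  have hvn : v < n := Finset.mem_range.1 hv
  refine slotTVG_crossable_iff.2 ⟨i, ?_, rfl⟩
  rw [slots_eq (by omega) hvn]
  rcases Nat.lt_or_ge v 2 with h | h
  · exact ⟨rfl, .inl ⟨by omega, hi⟩⟩
  · exact ⟨rfl, .inr ⟨h, .inr hiE⟩⟩

end Star

/-- No protocol solves fastest broadcast in all periodic TVGs with `n ≥ 3` nodes, even with a
common bound on the recurrence time. -/
theorem not_solves_fastest {n : ℕ} (hn3 : 3 ≤ n) {ζ : ℝ} (hζ : 0 < ζ) (A : Protocol)
    (h : ∀ G ∈ classP, G ∈ classB → G.ζ = ζ → G.nodes.card = n → G.RecurrenceBound (4 * ζ) →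
      A.Solves TDBfastest G) : False := by
  have hn : 0 < n := by omega
  have solves : ∀ (E : Set ℕ) (q : ℕ), 0 < q → (∀ k, k ∈ E ↔ k + 2 * q ∈ E) →
      A.Solves TDBfastest (slotTVG n hn ζ hζ (starSlots E)) := fun E q hq hE =>
    h _ (starSlots_mem_classP hq hE) (starSlots_mem_classB hq hE) rfl (Finset.card_range n)
      starSlots_recurrenceBound
  have h0n : 0 ∈ Finset.range n := Finset.mem_range.2 hn
  have hne : ∃ v ∈ Finset.range n, v ≠ 0 := ⟨1, Finset.mem_range.2 (by omega), one_ne_zero⟩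
  obtain ⟨⟨s, hs⟩, hall⟩ := solves ∅ 1 one_pos (fun _ => Iff.rfl) 0 h0n 0 le_rfl
  obtain ⟨⟨⟨ts, hts⟩, hinformed⟩, hfast⟩ := (hall s hs).2
  obtain ⟨e, l, he, hl, hel⟩ := hfast hne
  -- By `T` the emitter has stopped and both dates that define the duration have passed.
  set T := max ts (max e l)
  have hTts : ts ≤ T := le_max_left _ _
  have hTe : e ≤ T := (le_max_left _ _).trans (le_max_right _ _)
  have hTl : l ≤ T := (le_max_right _ _).trans (le_max_right _ _)
  obtain ⟨m, hm⟩ := exists_nat_gt (T / ζ)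
  rw [div_lt_iff₀ hζ] at hm
  -- The first extra slot is `2 * m`, which is even and begins after `T`; the period `2 * (m + 1)`
  -- is even, so it respects the parities.
  let E : Set ℕ := {k | 2 * (m + 1) ∣ k + 2}
  have hE : ∀ k, k ∈ E ↔ k + 2 * (m + 1) ∈ E := fun k => by
    change 2 * (m + 1) ∣ k + 2 ↔ 2 * (m + 1) ∣ k + 2 * (m + 1) + 2
    rw [show k + 2 * (m + 1) + 2 = k + 2 + 2 * (m + 1) by ring, Nat.dvd_add_self_right]
  obtain ⟨⟨s', hs'⟩, hall'⟩ := solves E (m + 1) (by omega) hE 0 h0n 0 le_rfl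
  obtain ⟨-, hfast'⟩ := (hall' s' hs').2
  obtain ⟨e', l', he', hl', hel'⟩ := hfast' hne
  have hG := slotTVG_present_congr (n := n) (hn := hn) (ζ := ζ) (hζ := hζ) (C := starSlots ∅)
    (C' := starSlots E) (m := 2 * m) (T := T) (fun a b k hk => by
      have : k ∉ E := fun hd => by
        have := Nat.le_of_dvd (by omega) hd
        omega
      change (_ ∧ (_ ∧ _ ∨ _ ∧ (_ ∨ _))) ↔ (_ ∧ (_ ∧ _ ∨ _ ∧ (_ ∨ _)))
      simp [this]) (by
      push_cast
      have : 0 ≤ m * ζ := by positivity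
      linarith)
  have hζeq : (slotTVG n hn ζ hζ (starSlots E)).ζ = (slotTVG n hn ζ hζ (starSlots ∅)).ζ := rfl
  have hemits := fun {v : ℕ} {t : ℝ} (ht : t ≤ T) => emits_congr (u := 0) (v := v) hζeq hG hs hs' ht
  have hrec := fun (v : ℕ) (a : ℝ) (ha : a ≤ T) => receptions_congr (v := v) hζeq hG hs hs' ha
  have hee : e' = e := by
    have h1 : e' ≤ e := by
      obtain ⟨v, hv⟩ := he.1
      exact he'.2 ⟨v, (hemits hTe).1 hv⟩
    refine le_antisymm h1 ?_
    obtain ⟨v, hv⟩ := he'.1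
    exact he.2 ⟨v, (hemits (h1.trans hTe)).2 hv⟩
  have hll : l' = l := by
    refine le_antisymm (hl.2 ?_) (hl'.2 ?_)
    · obtain ⟨v, hv, hv0, hr⟩ := hl'.1
      -- Termination is essential here: all nodes are informed by `ts ≤ T`, so no first reception in
      -- the modified star falls after the agreement ends.
      obtain ⟨b, hb, hbr⟩ := hinformed ts hts v hv hv0
      have hbT := hb.trans hTts
      exact ⟨v, hv, hv0, isLeast_of_agree (fun a ha => (hrec v a ha).symm)
        ((hr.2 ((hrec v b hbT).1 hbr)).trans hbT) hr⟩
    · obtain ⟨v, hv, hv0, hr⟩ := hl.1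
      exact ⟨v, hv, hv0, isLeast_of_agree (hrec v) hTl hr⟩
  have h1 := lt_of_mem_broadcastDurations hn3 hel.1
  have h2 : l' - e' ≤ ζ := hel'.2 (mem_broadcastDurations_of_even (i := 2 * m) (by simp)
    (show 2 * (m + 1) ∣ 2 * m + 2 from ⟨1, by ring⟩))
  rw [hee, hll] at h2
  linarith

/-! ### Impossibility of shortest broadcast -/

/-- A star with centre `0` whose edges are present in all slots, and where the other nodes are
linked during the slots in `E`. -/
def triangleSlots (E : Set ℕ) (u _ : ℕ) : Set ℕ := {k | u = 0 ∨ k ∈ E}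

theorem triangleSlots_mem_classP {E : Set ℕ} {q : ℕ} (hq : 0 < q)
    (hE : ∀ k, k ∈ E ↔ k + q ∈ E) :
    slotTVG 3 three_pos 1 one_pos (triangleSlots E) ∈ classP :=
  ⟨slotTVG_connected fun _ _ _ => ⟨0, .inl rfl⟩, _,
    slotTVG_periodicWith hq fun _ _ k _ _ => or_congr Iff.rfl (hE k)⟩

/-- No protocol solves shortest broadcast in all periodic TVGs with three nodes. -/
theorem not_solves_shortest (A : Protocol)
    (h : ∀ G ∈ classP, G.ζ = 1 → G.nodes.card = 3 → A.Solves TDBshortest G) : False := by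
  have solves : ∀ (E : Set ℕ) (q : ℕ), 0 < q → (∀ k, k ∈ E ↔ k + q ∈ E) →
      A.Solves TDBshortest (slotTVG 3 three_pos 1 one_pos (triangleSlots E)) := fun E q hq hE =>
    h _ (triangleSlots_mem_classP hq hE) rfl (Finset.card_range 3)
  have h1 : 1 ∈ Finset.range 3 := by simp
  have h2 : 2 ∈ Finset.range 3 := by simp
  obtain ⟨⟨s, hs⟩, hall⟩ := solves ∅ 1 one_pos (fun _ => Iff.rfl) 1 h1 0 le_rfl
  obtain ⟨r₀, k, d, hr₀, -⟩ := (hall s hs).2.2 2 h2 (by omega)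
  obtain ⟨m, hm⟩ := exists_nat_gt r₀
  -- The edge between `1` and `2` first shows up in slot `m`, after node `2` has been informed
  -- through node `0` at `r₀`.
  let E : Set ℕ := {k | m + 1 ∣ k + 1}
  have hE : ∀ k, k ∈ E ↔ k + (m + 1) ∈ E := fun k => by
    change m + 1 ∣ k + 1 ↔ m + 1 ∣ k + (m + 1) + 1
    rw [show k + (m + 1) + 1 = k + 1 + (m + 1) by ring, Nat.dvd_add_self_right]
  have hEm : ∀ k < m, k ∉ E := fun k hk hd => by
    have := Nat.le_of_dvd (by omega) hd
    omega
  have hcross : ∀ t, (slotTVG 3 three_pos 1 one_pos (triangleSlots E)).Crossable 1 2 t ↔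
      ∃ k ∈ E, t = 2 * k * 1 := fun t => by
    rw [slotTVG_crossable_iff, slots_eq (by omega) (by omega)]
    exact exists_congr fun k => and_congr_left fun _ => or_iff_right (by omega)
  obtain ⟨⟨s', hs'⟩, hall'⟩ := solves E (m + 1) (by omega) hE 1 h1 0 le_rfl
  obtain ⟨r, k, d', hr, hj, hk⟩ := (hall' s' hs').2.2 2 h2 (by omega)
  have hr₀m : r₀ < 2 * m * 1 := by
    have : (0 : ℝ) ≤ m := by positivity
    linarith
  have hG := slotTVG_present_congr (n := 3) (hn := three_pos) (ζ := 1) (hζ := one_pos)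
    (C := triangleSlots ∅) (C' := triangleSlots E) (m := m) (T := r₀)
    (fun a b k hk => or_congr Iff.rfl (iff_of_false id (hEm k hk))) hr₀m
  have hζeq : (slotTVG 3 three_pos 1 one_pos (triangleSlots E)).ζ =
    (slotTVG 3 three_pos 1 one_pos (triangleSlots ∅)).ζ := rfl
  have hle : r ≤ r₀ := hr.2 ((receptions_congr hζeq hG hs hs' le_rfl).1 hr₀.1)
  -- The late edge makes one hop the minimum, but a one-hop reception comes after `2 * m > r₀`,
  -- whereas by agreement the first reception is by `r₀`.
  have hk1 : k = 1 := by
    refine le_antisymm (hk.2 ⟨2 * m * 1, _, by simp, .single ((hcross _).2 ⟨m, ?_, rfl⟩)⟩)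
      (Journey.one_le hj)
    exact dvd_rfl
  subst hk1
  obtain ⟨⟨-, hc⟩, hrd⟩ := Journey.crossing_of_one hj
  obtain ⟨i, hi, rfl⟩ := (hcross _).1 hc
  have hrd' : r = 2 * i * 1 + 1 := hrd
  have : m ≤ i := by
    by_contra! hlt
    exact hEm i hlt hi
  have : (m : ℝ) ≤ i := by exact_mod_cast this
  linarith

/-! ### Feasibility in the contexts -/

theorem feasibleWith_of_mem {c : Context} {P : Problem} (h : P ∈ feasibleProblems c)
    (a : Advice) : FeasibleWith c a P :=
  let ⟨A, hA⟩ := h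
  ⟨A a, fun G hG hr => hA G hG a hr⟩

theorem foremost_feasible_of_count {c : Context} (hc : c.graphs ⊆ classR)
    (hn : Kind.n ∈ c.knowledge) : TDBforemost ∈ feasibleProblems c := by
  -- The default `0` is never used, since a correct advice contains `n`.
  refine ⟨fun a => gossip 1 View.holds (countNodes (a.n.getD 0)), fun G hG a ha => ?_⟩
  beta_reduce
  rw [ha.2.1 hn]
  exact gossip_solves_foremost (hc hG).1 (TVG.recurring_of_mem_classR (hc hG))
    (detects_countNodes G)

/-- `D` computes from the advice a bound on the time to wait for a crossing. -/
def BoundsCrossing (c : Context) (D : Advice → ℝ) : Prop :=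
  ∀ G ∈ c.graphs, ∀ a, Reveals c.knowledge G a →
    G.footprint.Connected ∧ G.CrossBound (D a) ∧ 0 ≤ D a

theorem foremost_feasible_of_bound {c : Context} {D : Advice → ℝ} (h : BoundsCrossing c D) :
    TDBforemost ∈ feasibleProblems c := by
  refine ⟨fun a => gossip 1 View.holds (closedNodes (D a)), fun G hG a ha => ?_⟩
  obtain ⟨h1, h2, -⟩ := h G hG a ha
  exact gossip_solves_foremost h1 h2.recurring (detects_closedNodes h1 h2)

theorem shortest_feasible_of_bound {c : Context} {D : Advice → ℝ} (h : BoundsCrossing c D) :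
    TDBshortest ∈ feasibleProblems c := by
  refine ⟨fun a => gossip (D a + a.ζ) (phaseActive (D a) (D a + a.ζ)) (closedNodes (D a)),
    fun G hG a ha => ?_⟩
  obtain ⟨h1, h2, h3⟩ := h G hG a ha
  beta_reduce
  rw [ha.1]
  exact gossip_solves_shortest h1 h2 h3 (detects_closedNodes h1 h2)

theorem boundsCrossing_Δ {c : Context} (hc : c.graphs ⊆ classR) (hΔ : Kind.Δ ∈ c.knowledge) :
    BoundsCrossing c fun a => a.Δ.getD 0 := by
  intro G hG a ha
  obtain ⟨Δ, h1, h2⟩ := ha.2.2.2.1 hΔ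
  simp only [h1, Option.getD_some]
  exact ⟨(hc hG).1, h2.crossBound (hc hG), h2.1.le⟩

theorem boundsCrossing_Pp : BoundsCrossing Pp fun a => a.p.getD 0 := by
  intro G hG a ha
  obtain ⟨p, h1, h2⟩ := ha.2.2.2.2.2.1 rfl
  simp only [h1, Option.getD_some]
  exact ⟨hG.1, h2.crossBound, h2.1.le⟩

theorem fastest_feasible_Pp : TDBfastest ∈ feasibleProblems Pp := by
  refine ⟨fun a => gossip 1 (fastestActive a.ζ (a.p.getD 0)) (closedNodes (a.p.getD 0)),
    fun G hG a ha => ?_⟩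
  obtain ⟨p, h1, h2⟩ := ha.2.2.2.2.2.1 rfl
  beta_reduce
  rw [ha.1, h1]
  exact gossip_solves_fastest hG.1 h2

/-- The condition `ha` says that the advice cannot tell the slotted stars apart: they share `ζ`, `n`
and the recurrence bound `4 * ζ`. -/
theorem not_feasibleWith_fastest {c : Context} (hc : ∀ G ∈ classP, G ∈ classB → G ∈ c.graphs)
    {a : Advice} {n : ℕ} (hn : 3 ≤ n) {ζ : ℝ} (hζ : 0 < ζ)
    (ha : ∀ G : TVG, G.ζ = ζ → G.nodes.card = n → G.RecurrenceBound (4 * ζ) →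
      Reveals c.knowledge G a) : ¬ FeasibleWith c a TDBfastest := fun ⟨A, hA⟩ =>
  not_solves_fastest hn hζ A fun G hP hB h1 h2 h3 => hA G (hc G hP hB) (ha G h1 h2 h3)

open Classical in
theorem fastest_not_feasible {c : Context} (hc : ∀ G ∈ classP, G ∈ classB → G ∈ c.graphs)
    (hp : Kind.p ∉ c.knowledge) : TDBfastest ∉ feasibleProblems c := fun h => by
  -- Three nodes and `ζ = 1`, hence the recurrence bound `4`; each is put in the advice only if the
  -- context reveals it.
  refine not_feasibleWith_fastest hc (a := ⟨1, if Kind.n ∈ c.knowledge then some 3 else none,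
    if Kind.Δ ∈ c.knowledge then some 4 else none, none⟩) le_rfl one_pos ?_
    (feasibleWith_of_mem h _)
  intro G h1 h2 h3
  rw [mul_one] at h3
  refine ⟨h1.symm, fun h => ?_, fun h => if_neg h, fun h => ⟨4, if_pos h, h3⟩,
    fun h => if_neg h, fun h => absurd h hp, fun _ => rfl⟩
  rw [h2]
  exact if_pos h

/-- With at most two nodes, a foremost broadcast is a shortest one. -/
theorem solves_shortest_of_card_le_two {A : Protocol} {G : TVG} (hG : G.nodes.card ≤ 2)
    (h : A.Solves TDBforemost G) : A.Solves TDBshortest G := by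
  intro x hx t₀ ht₀
  obtain ⟨hex, hall⟩ := h x hx t₀ ht₀
  refine ⟨hex, fun s hs => ?_⟩
  obtain ⟨hfin, hTDB, hfore⟩ := hall s hs
  refine ⟨hfin, hTDB, fun v hv hvx => ?_⟩
  obtain ⟨r, hr, hmin⟩ := hfore v hv hvx
  obtain ⟨w, t, he, hc, rfl, -⟩ := mem_receptions hr
  have hw : w = x := by
    by_contra hwx
    have hsub : ({v, x, w} : Finset ℕ) ⊆ G.nodes := by
      intro u hu
      simp only [Finset.mem_insert, Finset.mem_singleton] at hu
      rcases hu with rfl | rfl | rfl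
      exacts [hv, hx, hc.isEdge.left_mem]
    have hcard : ({v, x, w} : Finset ℕ).card = 3 :=
      Finset.card_eq_three.2 ⟨v, x, w, hvx, hc.isEdge.ne.symm, Ne.symm hwx, rfl⟩
    have := Finset.card_le_card hsub
    omega
  subst hw
  have hj : InfoJourney G (A.trace G w t₀ s) w v 1 t (t + G.ζ) := .single ⟨he, hc⟩
  refine ⟨t + G.ζ, 1, t, ⟨hr, ?_⟩, hj, ⟨t, _, hs.le_of_mem_receptions hj, hj.hasJourney⟩, ?_⟩
  · rintro b ⟨k, d, hb⟩
    exact hmin.2 ⟨k, d, hs.le_of_mem_receptions hb, hb.hasJourney⟩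
  · rintro k ⟨d, a, -, hk⟩
    exact Journey.one_le hk

/-- Shortest broadcast need not be feasible in such a context, so the comparison is made for each
value of `n`. For `n ≤ 2` a foremost protocol does; for `n ≥ 3` fastest broadcast is infeasible and
the implication is vacuous. -/
theorem notHarderIn_of_count {c : Context} (hc : c.graphs ⊆ classR)
    (hc' : ∀ G ∈ classP, G ∈ classB → G ∈ c.graphs) (hK : c.knowledge = {Kind.n}) :
    NotHarderIn c TDBshortest TDBfastest := by
  intro G hG a ha hfast
  have hn : Kind.n ∈ c.knowledge := by rw [hK]; rfl
  have hΔ : Kind.Δ ∉ c.knowledge := by rw [hK]; simp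
  have hp : Kind.p ∉ c.knowledge := by rw [hK]; simp
  rcases le_or_gt G.nodes.card 2 with h2 | h3
  · obtain ⟨A, hA⟩ := feasibleWith_of_mem (foremost_feasible_of_count hc hn) a
    refine ⟨A, fun G' hG' ha' => solves_shortest_of_card_le_two ?_ (hA G' hG' ha')⟩
    have := (ha'.2.1 hn).symm.trans (ha.2.1 hn)
    rw [Option.some.inj this]
    exact h2
  · refine absurd hfast (not_feasibleWith_fastest hc' h3 G.ζ_pos fun G' h1 h2 _ => ?_)
    refine ⟨ha.1.trans h1.symm, fun h => ?_, fun h => absurd hn h, fun h => absurd h hΔ,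
      ha.2.2.2.2.1, fun h => absurd h hp, ha.2.2.2.2.2.2⟩
    rw [h2, ha.2.1 hn]

theorem classB_subset_classR : classB ⊆ classR := fun _ h => h.1

theorem shortest_not_feasible_Pn : TDBshortest ∉ feasibleProblems Pn := by
  rintro ⟨A, hA⟩
  refine not_solves_shortest (A ⟨1, some 3, none, none⟩) fun G hG h1 h2 => hA G hG _ ?_
  refine ⟨h1.symm, fun _ => by rw [h2], fun h => absurd rfl h, fun h => ?_, fun _ => rfl,
    fun h => ?_, fun _ => rfl⟩
  · exact absurd h (by simp [Pn])
  · exact absurd h (by simp [Pn])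

/-- The contexts that reveal the number of nodes only, those that reveal a recurrence bound, and
the one that reveals the period. -/
theorem universeU_cases {c : Context} (hc : c ∈ universeU) :
    (c.graphs ⊆ classR ∧ (∀ G ∈ classP, G ∈ classB → G ∈ c.graphs) ∧
      (c.knowledge = {Kind.n} ∨ (Kind.Δ ∈ c.knowledge ∧ Kind.p ∉ c.knowledge))) ∨ c = Pp := by
  have hRB : ∀ G ∈ classP, G ∈ classB → G ∈ classR := fun _ _ h => h.1
  have hB : ∀ G ∈ classP, G ∈ classB → G ∈ classB := fun _ _ h => h
  have hP : ∀ G ∈ classP, G ∈ classB → G ∈ classP := fun _ h _ => h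
  rcases hc with rfl | rfl | rfl | rfl | rfl | rfl | rfl | rfl
  · exact .inl ⟨subset_rfl, hRB, .inl rfl⟩
  · exact .inl ⟨classB_subset_classR, hB, .inl rfl⟩
  · exact .inl ⟨classB_subset_classR, hB, .inr (by simp [BΔ])⟩
  · exact .inl ⟨classB_subset_classR, hB, .inr (by simp [BnΔ])⟩
  · exact .inl ⟨TVG.classP_subset_classR, hP, .inl rfl⟩
  · exact .inl ⟨TVG.classP_subset_classR, hP, .inr (by simp [PΔ])⟩
  · exact .inl ⟨TVG.classP_subset_classR, hP, .inr (by simp [PnΔ])⟩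
  · exact .inr rfl

theorem foremost_feasible {c : Context} (hc : c ∈ universeU) :
    TDBforemost ∈ feasibleProblems c := by
  obtain ⟨h1, -, h | h⟩ | rfl := universeU_cases hc
  · exact foremost_feasible_of_count h1 (by rw [h]; rfl)
  · exact foremost_feasible_of_bound (boundsCrossing_Δ h1 h.1)
  · exact foremost_feasible_of_bound boundsCrossing_Pp

theorem fastest_feasible_iff {c : Context} (hc : c ∈ universeU) :
    TDBfastest ∈ feasibleProblems c ↔ c = Pp := by
  refine ⟨fun h => ?_, fun h => h ▸ fastest_feasible_Pp⟩
  obtain ⟨-, h2, h3⟩ | h' := universeU_cases hc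
  · exact absurd h (fastest_not_feasible h2 (h3.elim (fun h => by rw [h]; simp) fun h => h.2))
  · exact h'

theorem foremost_easier_shortest : Easier universeU TDBforemost TDBshortest :=
  ⟨fun _ hc _ _ a _ _ => feasibleWith_of_mem (foremost_feasible hc) a, Pn, by simp [universeU],
    foremost_feasible (by simp [universeU]), shortest_not_feasible_Pn⟩

theorem shortest_easier_fastest : Easier universeU TDBshortest TDBfastest := by
  refine ⟨fun c hc => ?_, PΔ, by simp [universeU], ?_, ?_⟩
  · obtain ⟨h1, h2, h | h⟩ | rfl := universeU_cases hc
    · exact notHarderIn_of_count h1 h2 h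
    · exact fun _ _ a _ _ =>
        feasibleWith_of_mem (shortest_feasible_of_bound (boundsCrossing_Δ h1 h.1)) a
    · exact fun _ _ a _ _ =>
        feasibleWith_of_mem (shortest_feasible_of_bound boundsCrossing_Pp) a
  · exact shortest_feasible_of_bound (boundsCrossing_Δ TVG.classP_subset_classR rfl)
  · exact fastest_not_feasible (fun _ h _ => h) (by simp [PΔ])

end DynNet

theorem mainTheorem2 :
    DynNet.Easier DynNet.universeU DynNet.TDBforemost DynNet.TDBshortest ∧
    DynNet.Easier DynNet.universeU DynNet.TDBshortest DynNet.TDBfastest ∧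
    (∀ c ∈ DynNet.universeU, DynNet.TDBforemost ∈ DynNet.feasibleProblems c) ∧
    DynNet.TDBshortest ∉ DynNet.feasibleProblems DynNet.Pn ∧
    (∀ c ∈ DynNet.universeU,
      DynNet.TDBfastest ∈ DynNet.feasibleProblems c ↔ c = DynNet.Pp) :=
  ⟨DynNet.foremost_easier_shortest, DynNet.shortest_easier_fastest,
    fun _ hc => DynNet.foremost_feasible hc, DynNet.shortest_not_feasible_Pn,
    fun _ hc => DynNet.fastest_feasible_iff hc⟩
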